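/- Let $I=[0,1]$ and let $I\times\{0,1,2,\dots\}$ be the disjoint union of countably many copies of $I$. The Hawaiian ropes $\mathrm{HR}$ is the quotient space of $I\times\{0,1,2,\dots\}$ by the equivalence relation generated by $(0,n)\sim(0,0)$ and $(1,n)\sim(1/n,0)$ for $n\ge 1$. Let $A\subset\mathrm{HR}$ be the union of the ropes, i.e. of the images of $I\times\{n\}$ for $n\ge 1$; let $\mathrm{HR}/A$ be the quotient space in which $A$ is collapsed to a point, and $\pi:\mathrm{HR}\to\mathrm{HR}/A$ the quotient map. Let $Y$ be the wedge of countably many circles, i.e. the quotient space of $\{(0,0)\}\cup (I\times\{1,2,\dots\})$ by the equivalence relation generated by $(0,n)\sim(0,0)\sim(1,n)$ for $n\ge 1$, and let $\mathrm{HE}\subset\mathbb{R}^2$ be the Hawaiian earring $$\mathrm{HE}=\bigcup_{n\ge1}\Bigl\{(x,y)\in\mathbb{R}^2 : \bigl(x-1+\tfrac1{2n}\bigr)^2+y^2=\bigl(\tfrac1{2n}\bigr)^2\Bigr\}.$$ Then: 1. $\mathrm{HR}$ is homotopy equivalent to $Y$, and for every base point $\pi_1(\mathrm{HR})$ is free on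 countably infinitely many generators; in particular it is countable. 2. $A$ is closed in $\mathrm{HR}$, and $\mathrm{HR}/A$ is homeomorphic to $\mathrm{HE}$. For every base point, $\pi_1(\mathrm{HR}/A)$ is uncountable and is not a free group. 3. $\mathrm{HR}$ is locally path connected and every fiber of $\pi$ is connected, but $\mathrm{HR}/A$ is not semi-locally simply connected (that is, it is not true that every point has a neighborhood in which every loop based at the point is null-homotopic in $\mathrm{HR}/A$), and for every base point in $\mathrm{HR}$ the homomorphism $\pi_\sharp:\pi_1(\mathrm{HR})\to\pi_1(\mathrm{HR}/A)$ is not surjective. Hence the following assertion becomes false if its semi-local simple connectivity hypothesis is dropped: if a locally path connected space $X$ is partitioned into connected subsets and the quotient space $X/{\sim}$ is semi-locally simply connected, then $\pi_1(X)\to\pi_1(X/{\sim})$ is surjective for each choice of base point in $X$. -/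

import Mathlib

open scoped unitInterval Topology ContinuousMap

noncomputable section

namespace HawaiianRopes

/-- The point `1/n` of the unit interval. It is used only for `n ≥ 1`. -/
def invNat (n : ℕ) : I := ⟨1 / (n : ℝ), by positivity, by simpa using Nat.cast_inv_le_one (α := ℝ) n⟩

/-- The gluing relation on the disjoint union `I × ℕ` of countably many unit intervals:
for `n ≥ 1`, the end `(0, n)` is attached to `(0, 0)` and the end `(1, n)` to `(1/n, 0)`. -/
inductive RopeRel : I × ℕ → I × ℕ → Prop
  | zero (n : ℕ) (hn : 1 ≤ n) : RopeRel (0, n) (0, 0)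
  | one (n : ℕ) (hn : 1 ≤ n) : RopeRel (1, n) (invNat n, 0)

/-- The Hawaiian ropes: the quotient of `I × ℕ` by the equivalence relation generated by
`RopeRel`, with the quotient topology. -/
abbrev HR : Type := Quot RopeRel

/-- The union `A` of the ropes: the image in `HR` of the intervals `I × {n}`, `n ≥ 1`. -/
def ropes : Set HR := ⋃ n ≥ 1, Quot.mk RopeRel '' {p : I × ℕ | p.2 = n}

/-- `I × ℕ` with `(0, 1] × {0}` removed: a point together with the intervals `I × {n}`, `n ≥ 1`. -/
abbrev PreWedge : Type := {p : I × ℕ // p.2 = 0 → p.1 = 0}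

/-- The point `(s, n)` of `PreWedge`, for `n ≥ 1`. -/
def PreWedge.pt (s : I) (n : ℕ) (hn : 1 ≤ n) : PreWedge :=
  ⟨(s, n), fun h => absurd h (Nat.one_le_iff_ne_zero.mp hn)⟩

/-- The point `(0, 0)` of `PreWedge`. -/
def PreWedge.base : PreWedge := ⟨(0, 0), fun _ => rfl⟩

/-- Both ends of every interval `I × {n}`, `n ≥ 1`, are attached to the base point. -/
inductive WedgeRel : PreWedge → PreWedge → Prop
  | zero (n : ℕ) (hn : 1 ≤ n) : WedgeRel (PreWedge.pt 0 n hn) PreWedge.base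
  | one (n : ℕ) (hn : 1 ≤ n) : WedgeRel (PreWedge.pt 1 n hn) PreWedge.base

/-- The wedge of countably many circles, with the quotient topology. -/
abbrev CircleWedge : Type := Quot WedgeRel

/-- The Hawaiian earring: the union of the circles with centre `(1 - 1/(2n), 0)` and
radius `1/(2n)`, `n ≥ 1`, as a subspace of the plane. -/
def earring : Set (ℝ × ℝ) :=
  {p | ∃ n : ℕ, 1 ≤ n ∧ (p.1 - (1 - 1 / (2 * (n : ℝ)))) ^ 2 + p.2 ^ 2 = (1 / (2 * (n : ℝ))) ^ 2}

/-- The equivalence relation on `X` whose classes are `A` and the points outside `A`. -/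
def collapseSetoid {X : Type} (A : Set X) : Setoid X where
  r x y := x = y ∨ (x ∈ A ∧ y ∈ A)
  iseqv :=
    { refl := fun _ => Or.inl rfl
      symm := by
        rintro x y (h | h)
        · exact Or.inl h.symm
        · exact Or.inr h.symm
      trans := by
        rintro x y z (rfl | h) (rfl | h')
        · exact Or.inl rfl
        · exact Or.inr h'
        · exact Or.inr h
        · exact Or.inr ⟨h.1, h'.2⟩ }

/-- The quotient space `X / A`, obtained by collapsing `A` to a point. -/
abbrev Collapse {X : Type} (A : Set X) : Type := Quotient (collapseSetoid A)

/-- The quotient map `X → X / A`. -/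
def collapseMap {X : Type} [TopologicalSpace X] (A : Set X) : C(X, Collapse A) :=
  ⟨Quotient.mk (collapseSetoid A), continuous_quot_mk⟩

/-- Every point `x` has a neighbourhood `U` such that every loop in `U` based at `x` is
null-homotopic in the whole space. -/
def SemilocallySimplyConnected (X : Type) [TopologicalSpace X] : Prop :=
  ∀ x : X, ∃ U ∈ 𝓝 x, ∀ γ : Path x x, (∀ t, γ t ∈ U) → γ.Homotopic (Path.refl x)

end HawaiianRopes

end

noncomputable section

namespace HawaiianRopes

/-! ### Points of the two quotient spaces -/

/-! Because `HR` has the quotient topology, a homotopy on it is continuous once it is so on each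
interval, and contracting the base interval is a homotopy equivalence with the wedge of circles. The
group of the wedge is free. A covering with fibre the free group, on which the circles act by left
multiplication with the generators, separates words (`wedgeHom_injective`). A subdivision of the
unit interval writes every loop as a word (`isGood_pathClass`).

Collapsing the ropes identifies `0` and all the points `1 / n` of the base interval. Each `[1 / (n +
1), 1 / n]` closes up to a circle, and these circles shrink to the base point since the intervals
accumulate at `0`. The resulting continuous bijection from a compact space onto the earring is a
homeomorphism.

For the earring, let `c n` be the circle number `2 ^ n` and `w m` the winding number around `c m`.
For every sequence `k` of exponents there are loops with `x n = x (n + 1) ^ k n * c n`, where `w m`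
kills `x n` for `m < n`. Hence `w m (x 0)` is the product of the `k i` with `i < m`; exponents in
`{1, 2}` already give uncountably many classes. If the group were free, exponents exceeding the `ℓ¹`
norms of the abelianized `c n` would make the norms of the abelianized `x n` decrease until one
vanishes, contradicting `w n (x n) = 1` (additively). Finally, a countable group cannot surject onto
an uncountable one, and arbitrarily small circles have winding number one. -/

/-- The image of `(s, n)` in `HR`. -/
def HR.pt (n : ℕ) (s : I) : HR := Quot.mk RopeRel (s, n)

theorem HR.exists_pt (x : HR) : ∃ n s, HR.pt n s = x := by
  induction x using Quot.ind with
  | mk p => exact ⟨p.2, p.1, rfl⟩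

theorem HR.pt_zero (n : ℕ) : HR.pt n 0 = HR.pt 0 0 := by
  rcases Nat.eq_zero_or_pos n with rfl | hn
  · rfl
  · exact Quot.sound (RopeRel.zero n hn)

theorem HR.pt_one {n : ℕ} (hn : 1 ≤ n) : HR.pt n 1 = HR.pt 0 (invNat n) :=
  Quot.sound (RopeRel.one n hn)

theorem HR.continuous_pt (n : ℕ) : Continuous (HR.pt n) :=
  continuous_quot_mk.comp (by fun_prop)

/-- A map out of `HR × T` is continuous as soon as it is so on each interval. -/
theorem HR.continuous_of_pt {T Z : Type*} [TopologicalSpace T] [TopologicalSpace Z]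
    [LocallyCompactSpace T] {g : HR × T → Z}
    (h : ∀ n, Continuous fun p : I × T => g (HR.pt n p.1, p.2)) : Continuous g := by
  -- The product of a quotient map with the identity of a locally compact space is again a quotient
  -- map. This is what makes homotopies defined interval by interval continuous.
  refine (isQuotientMap_quot_mk (r := RopeRel)).continuous_lift_prod_left ?_
  have : Continuous fun q : (I × T) × ℕ => g (HR.pt q.2 q.1.1, q.1.2) :=
    continuous_prod_of_discrete_right.2 h
  exact this.comp (f := fun p : (I × ℕ) × T => ((p.1.1, p.2), p.1.2)) (by fun_prop)

theorem HR.continuous_of_pt' {Z : Type*} [TopologicalSpace Z] {g : HR → Z}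
    (h : ∀ n, Continuous fun s => g (HR.pt n s)) : Continuous g := by
  have : Continuous fun p : HR × Unit => g p.1 :=
    HR.continuous_of_pt fun n => (h n).comp continuous_fst
  exact this.comp (f := fun x => (x, ())) (by fun_prop)

/-- A map out of `HR` given by its restrictions to the intervals. -/
def HR.lift {Z : Type*} (g : ℕ → I → Z) (h0 : ∀ n, g n 0 = g 0 0)
    (h1 : ∀ n, 1 ≤ n → g n 1 = g 0 (invNat n)) : HR → Z :=
  Quot.lift (fun p => g p.2 p.1) (by
    rintro _ _ (⟨n, hn⟩ | ⟨n, hn⟩)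
    · exact h0 n
    · exact h1 n hn)

/-- The point of the wedge with parameter `s` on the `n`-th circle, and the base point
for `n = 0`. -/
def CircleWedge.pt (n : ℕ) (s : I) : CircleWedge :=
  Quot.mk WedgeRel ⟨(if n = 0 then 0 else s, n), fun h => if_pos h⟩

/-- The base point of the wedge. -/
def CircleWedge.base : CircleWedge := Quot.mk WedgeRel PreWedge.base

theorem CircleWedge.pt_of_one_le {n : ℕ} (hn : 1 ≤ n) (s : I) :
    CircleWedge.pt n s = Quot.mk WedgeRel (PreWedge.pt s n hn) := by
  have : n ≠ 0 := by omega
  simp [CircleWedge.pt, PreWedge.pt, this]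

theorem CircleWedge.pt_zero_left (s : I) : CircleWedge.pt 0 s = CircleWedge.base := by
  simp [CircleWedge.pt, CircleWedge.base, PreWedge.base]

theorem CircleWedge.pt_zero (n : ℕ) : CircleWedge.pt n 0 = CircleWedge.base := by
  rcases Nat.eq_zero_or_pos n with rfl | hn
  · exact pt_zero_left 0
  · rw [pt_of_one_le hn]
    exact Quot.sound (WedgeRel.zero n hn)

theorem CircleWedge.pt_one (n : ℕ) : CircleWedge.pt n 1 = CircleWedge.base := by
  rcases Nat.eq_zero_or_pos n with rfl | hn
  · exact pt_zero_left 1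
  · rw [pt_of_one_le hn]
    exact Quot.sound (WedgeRel.one n hn)

theorem CircleWedge.mk_eq_pt (p : PreWedge) : Quot.mk WedgeRel p = CircleWedge.pt p.1.2 p.1.1 := by
  obtain ⟨⟨s, n⟩, h⟩ := p
  simp only [CircleWedge.pt]
  congr 3
  split_ifs with h'
  · exact h h'
  · rfl

theorem CircleWedge.exists_pt (x : CircleWedge) : ∃ n s, CircleWedge.pt n s = x := by
  induction x using Quot.ind with
  | mk p => exact ⟨p.1.2, p.1.1, (CircleWedge.mk_eq_pt p).symm⟩

theorem CircleWedge.continuous_pt (n : ℕ) : Continuous (CircleWedge.pt n) := by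
  refine continuous_quot_mk.comp (Continuous.subtype_mk ?_ _)
  split_ifs <;> fun_prop

/-- A map out of `CircleWedge × T` is continuous as soon as it is so on each circle. -/
theorem CircleWedge.continuous_of_pt {T Z : Type*} [TopologicalSpace T] [TopologicalSpace Z]
    [LocallyCompactSpace T] {g : CircleWedge × T → Z}
    (h : ∀ n, Continuous fun p : I × T => g (CircleWedge.pt n p.1, p.2)) : Continuous g := by
  refine (isQuotientMap_quot_mk (r := WedgeRel)).continuous_lift_prod_left ?_
  simp only [CircleWedge.mk_eq_pt]
  have : Continuous fun q : (I × T) × ℕ => g (CircleWedge.pt q.2 q.1.1, q.1.2) :=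
    continuous_prod_of_discrete_right.2 h
  exact this.comp (f := fun p : PreWedge × T => ((p.1.1.1, p.2), p.1.1.2)) (by fun_prop)

theorem CircleWedge.continuous_of_pt' {Z : Type*} [TopologicalSpace Z] {g : CircleWedge → Z}
    (h : ∀ n, Continuous fun s => g (CircleWedge.pt n s)) : Continuous g := by
  have : Continuous fun p : CircleWedge × Unit => g p.1 :=
    CircleWedge.continuous_of_pt fun n => (h n).comp continuous_fst
  exact this.comp (f := fun x => (x, ())) (by fun_prop)

theorem CircleWedge.isOpen_iff {U : Set CircleWedge} :
    IsOpen U ↔ ∀ n, IsOpen (CircleWedge.pt n ⁻¹' U) := by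
  refine ⟨fun h n => h.preimage (continuous_pt n), fun h => ?_⟩
  rw [← (isQuotientMap_quot_mk (r := WedgeRel)).isOpen_preimage]
  have : IsOpen {q : I × ℕ | CircleWedge.pt q.2 q.1 ∈ U} := by
    rw [isOpen_prod_iff]
    intro s n hs
    exact ⟨_, {n}, h n, isOpen_discrete _, hs, rfl, by rintro ⟨s', n'⟩ ⟨h1, rfl⟩; exact h1⟩
  convert this.preimage (continuous_subtype_val : Continuous (Subtype.val : PreWedge → I × ℕ))
  ext p
  simp [CircleWedge.mk_eq_pt]

/-- A map out of the wedge given by its restrictions to the circles. -/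
def CircleWedge.lift {Z : Type*} (g : ℕ → I → Z) (z : Z) (h : ∀ s, g 0 s = z)
    (h0 : ∀ n, g n 0 = z) (h1 : ∀ n, g n 1 = z) : CircleWedge → Z :=
  Quot.lift (fun p => g p.1.2 p.1.1) (by
    rintro _ _ (⟨n, hn⟩ | ⟨n, hn⟩)
    · exact (h0 n).trans (h 0).symm
    · exact (h1 n).trans (h 0).symm)

theorem CircleWedge.lift_pt {Z : Type*} (g : ℕ → I → Z) (z : Z) (h : ∀ s, g 0 s = z)
    (h0 : ∀ n, g n 0 = z) (h1 : ∀ n, g n 1 = z) (n : ℕ) (s : I) :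
    CircleWedge.lift g z h h0 h1 (CircleWedge.pt n s) = g n s := by
  rcases Nat.eq_zero_or_pos n with rfl | hn
  · rw [pt_zero_left, h]
    exact h 0
  · rw [pt_of_one_le hn]
    rfl

theorem joined_unitInterval (s t : I) : Joined s t :=
  (isPathConnected_iff_pathConnectedSpace.1
    ((convex_Icc (0 : ℝ) 1).isPathConnected ⟨0, by simp⟩)).joined s t

instance : PathConnectedSpace CircleWedge where
  nonempty := ⟨CircleWedge.base⟩
  joined := by
    suffices h : ∀ x : CircleWedge, Joined CircleWedge.base x from
      fun x y => (h x).symm.trans (h y)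
    intro x
    obtain ⟨n, s, rfl⟩ := CircleWedge.exists_pt x
    have := (joined_unitInterval 0 s).map (CircleWedge.continuous_pt n)
    rwa [CircleWedge.pt_zero] at this

instance : PathConnectedSpace HR where
  nonempty := ⟨HR.pt 0 0⟩
  joined := by
    suffices h : ∀ x : HR, Joined (HR.pt 0 0) x from
      fun x y => (h x).symm.trans (h y)
    intro x
    obtain ⟨n, s, rfl⟩ := HR.exists_pt x
    have := (joined_unitInterval 0 s).map (HR.continuous_pt n)
    rwa [HR.pt_zero] at this

/-! ### The homotopy equivalence between `HR` and the wedge of circles -/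

/-- The path which runs along the `n`-th rope and then, on the base interval, from `1 / n`
towards `0`. -/
def ropeBack (n : ℕ) (u : ℝ) : HR :=
  if u ≤ 1 then HR.pt n (Set.projIcc 0 1 zero_le_one u)
  else HR.pt 0 (Set.projIcc 0 1 zero_le_one ((2 - u) * invNat n))

theorem continuous_ropeBack {n : ℕ} (hn : 1 ≤ n) : Continuous (ropeBack n) := by
  refine Continuous.if_le ((HR.continuous_pt n).comp continuous_projIcc)
    ((HR.continuous_pt 0).comp (continuous_projIcc.comp (by fun_prop))) (by fun_prop)
    (by fun_prop) ?_
  rintro u rfl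
  rw [Set.projIcc_right]
  have : (2 - 1 : ℝ) * invNat n = invNat n := by ring
  rw [this, Set.projIcc_val]
  exact HR.pt_one hn

theorem ropeBack_zero (n : ℕ) : ropeBack n 0 = HR.pt 0 0 := by
  simp [ropeBack, HR.pt_zero]

theorem ropeBack_coe (n : ℕ) (s : I) : ropeBack n s = HR.pt n s := by
  simp [ropeBack, s.2.2]

theorem ropeBack_of_one_le {n : ℕ} (hn : 1 ≤ n) {u : ℝ} (hu : 1 ≤ u) :
    ropeBack n u = HR.pt 0 (Set.projIcc 0 1 zero_le_one ((2 - u) * invNat n)) := by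
  rcases hu.eq_or_lt with rfl | hu
  · have : (2 - 1 : ℝ) * invNat n = invNat n := by ring
    rw [this, Set.projIcc_val, ← HR.pt_one hn]
    exact ropeBack_coe n 1
  · rw [ropeBack, if_neg hu.not_ge]

theorem ropeBack_two {n : ℕ} (hn : 1 ≤ n) : ropeBack n 2 = HR.pt 0 0 := by
  simp [ropeBack_of_one_le hn]

/-- Collapse the base interval of `HR`. -/
def HR.toWedge : C(HR, CircleWedge) where
  toFun := HR.lift CircleWedge.pt (fun n => by simp only [CircleWedge.pt_zero])
    (fun n _ => by rw [CircleWedge.pt_one, CircleWedge.pt_zero_left])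
  continuous_toFun := HR.continuous_of_pt' CircleWedge.continuous_pt

theorem HR.toWedge_pt (n : ℕ) (s : I) : HR.toWedge (HR.pt n s) = CircleWedge.pt n s := rfl

/-- Send the `n`-th circle to the `n`-th rope followed by the base interval from `1 / n` to `0`. -/
def CircleWedge.toHR : C(CircleWedge, HR) where
  toFun := CircleWedge.lift (fun n s => if n = 0 then HR.pt 0 0 else ropeBack n (2 * s)) (HR.pt 0 0)
    (by simp) (by simp [ropeBack_zero]) (by
      intro n
      split_ifs with hn
      · rfl
      · simpa using ropeBack_two (Nat.one_le_iff_ne_zero.2 hn))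
  continuous_toFun := CircleWedge.continuous_of_pt' fun n => by
    simp only [CircleWedge.lift_pt]
    split_ifs with hn
    · fun_prop
    · exact (continuous_ropeBack (Nat.one_le_iff_ne_zero.2 hn)).comp (by fun_prop)

theorem CircleWedge.toHR_pt {n : ℕ} (hn : 1 ≤ n) (s : I) :
    CircleWedge.toHR (CircleWedge.pt n s) = ropeBack n (2 * s) := by
  have h : n ≠ 0 := by omega
  simp [CircleWedge.toHR, CircleWedge.lift_pt, h]

theorem CircleWedge.toHR_pt_zero (s : I) :
    CircleWedge.toHR (CircleWedge.pt 0 s) = HR.pt 0 0 := by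
  simp [CircleWedge.toHR, CircleWedge.lift_pt]

/-- The deformation of `HR` which contracts the base interval. -/
def HR.contract (n : ℕ) (s t : I) : HR :=
  if n = 0 then HR.pt 0 (s * t) else ropeBack n (s * (2 - t))

theorem HR.contract_zero (n : ℕ) (t : I) : HR.contract n 0 t = HR.contract 0 0 t := by
  by_cases hn : n = 0 <;> simp [HR.contract, hn, ropeBack_zero]

/-- As `2 - t ≥ 1`, the end of the rope has already turned back onto the base interval, at `t / n`,
which is where the contraction moves `1 / n`. -/
theorem HR.contract_one {n : ℕ} (hn : 1 ≤ n) (t : I) :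
    HR.contract n 1 t = HR.contract 0 (invNat n) t := by
  have hn' : n ≠ 0 := by omega
  have h1 : (1 : ℝ) ≤ 2 - t := by linarith [t.2.2]
  simp only [HR.contract, hn', if_false, if_true, Set.Icc.coe_one, one_mul]
  rw [ropeBack_of_one_le hn h1]
  congr 1
  rw [← Set.projIcc_val zero_le_one (invNat n * t)]
  congr 1
  push_cast
  ring

/-- The homotopy from collapsing the base interval and expanding again to the identity. -/
def HR.contractHomotopy : (CircleWedge.toHR.comp HR.toWedge).Homotopy (ContinuousMap.id HR) where
  toFun p := HR.lift (fun n s => HR.contract n s p.1) (fun n => HR.contract_zero n p.1)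
    (fun _ hn => HR.contract_one hn p.1) p.2
  continuous_toFun := by
    refine Continuous.comp (g := fun q : HR × I => HR.lift (fun n s => HR.contract n s q.2)
      (fun n => HR.contract_zero n q.2) (fun _ hn => HR.contract_one hn q.2) q.1)
      (HR.continuous_of_pt ?_) continuous_swap
    intro n
    change Continuous fun p : I × I => HR.contract n p.1 p.2
    by_cases hn : n = 0
    · simp only [HR.contract, hn, if_true]
      exact (HR.continuous_pt 0).comp (by fun_prop)
    · simp only [HR.contract, hn, if_false]
      exact (continuous_ropeBack (Nat.one_le_iff_ne_zero.2 hn)).comp (by fun_prop)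
  map_zero_left x := by
    obtain ⟨n, s, rfl⟩ := HR.exists_pt x
    change HR.contract n s 0 = CircleWedge.toHR (HR.toWedge (HR.pt n s))
    rw [HR.toWedge_pt]
    by_cases hn : n = 0
    · subst hn
      rw [CircleWedge.toHR_pt_zero]
      simp [HR.contract]
    · rw [CircleWedge.toHR_pt (Nat.one_le_iff_ne_zero.2 hn)]
      simp [HR.contract, hn, mul_comm]
  map_one_left x := by
    obtain ⟨n, s, rfl⟩ := HR.exists_pt x
    change HR.contract n s 1 = HR.pt n s
    by_cases hn : n = 0
    · subst hn
      simp [HR.contract]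
    · simp only [HR.contract, hn, if_false]
      norm_num
      exact ropeBack_coe n s

/-- The return leg lies on the base interval, which is collapsed, so the image traverses the circle
once and then waits. -/
theorem HR.toWedge_ropeBack (n : ℕ) (u : ℝ) :
    HR.toWedge (ropeBack n u) = CircleWedge.pt n (Set.projIcc 0 1 zero_le_one u) := by
  rw [ropeBack]
  split_ifs with h
  · rfl
  · rw [HR.toWedge_pt, CircleWedge.pt_zero_left, Set.projIcc_of_right_le _ (not_le.1 h).le]
    exact (CircleWedge.pt_one n).symm

theorem CircleWedge.pt_slow_zero (n : ℕ) (t : I) :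
    CircleWedge.pt n (Set.projIcc 0 1 zero_le_one ((0 : I) * (2 - t : ℝ))) = CircleWedge.base := by
  simp [CircleWedge.pt_zero]

theorem CircleWedge.pt_slow_one (n : ℕ) (t : I) :
    CircleWedge.pt n (Set.projIcc 0 1 zero_le_one ((1 : I) * (2 - t : ℝ))) = CircleWedge.base := by
  have h1 : (1 : ℝ) ≤ 2 - t := by linarith [t.2.2]
  simp only [Set.Icc.coe_one, one_mul, Set.projIcc_of_right_le zero_le_one h1]
  exact CircleWedge.pt_one n

/-- The reparametrization of the circles of the wedge. -/
def CircleWedge.reparam :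
    (HR.toWedge.comp CircleWedge.toHR).Homotopy (ContinuousMap.id CircleWedge) where
  toFun p := CircleWedge.lift
    (fun n s => CircleWedge.pt n (Set.projIcc 0 1 zero_le_one (s * (2 - p.1)))) CircleWedge.base
    (fun s => CircleWedge.pt_zero_left _)
    (fun n => CircleWedge.pt_slow_zero n p.1) (fun n => CircleWedge.pt_slow_one n p.1) p.2
  continuous_toFun := by
    refine Continuous.comp (g := fun q : CircleWedge × I => CircleWedge.lift
      (fun n s => CircleWedge.pt n (Set.projIcc 0 1 zero_le_one (s * (2 - q.2)))) CircleWedge.base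
      (fun s => CircleWedge.pt_zero_left _) (fun n => CircleWedge.pt_slow_zero n q.2)
      (fun n => CircleWedge.pt_slow_one n q.2) q.1) (CircleWedge.continuous_of_pt ?_) continuous_swap
    intro n
    simp only [CircleWedge.lift_pt]
    exact (CircleWedge.continuous_pt n).comp (continuous_projIcc.comp (by fun_prop))
  map_zero_left x := by
    obtain ⟨n, s, rfl⟩ := CircleWedge.exists_pt x
    simp only [CircleWedge.lift_pt, ContinuousMap.comp_apply]
    by_cases hn : n = 0
    · subst hn
      rw [CircleWedge.toHR_pt_zero, HR.toWedge_pt, CircleWedge.pt_zero_left,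
        CircleWedge.pt_zero_left]
    · rw [CircleWedge.toHR_pt (Nat.one_le_iff_ne_zero.2 hn), HR.toWedge_ropeBack]
      simp [mul_comm]
  map_one_left x := by
    obtain ⟨n, s, rfl⟩ := CircleWedge.exists_pt x
    simp only [CircleWedge.lift_pt, ContinuousMap.id_apply]
    norm_num

/-- `HR` is homotopy equivalent to the wedge of circles. -/
def HR.homotopyEquivWedge : HR ≃ₕ CircleWedge where
  toFun := HR.toWedge
  invFun := CircleWedge.toHR
  left_inv := ⟨HR.contractHomotopy⟩
  right_inv := ⟨CircleWedge.reparam⟩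

/-! ### The ropes -/

theorem HR.pt_mem_ropes {n : ℕ} (hn : 1 ≤ n) (s : I) : HR.pt n s ∈ ropes :=
  Set.mem_biUnion (show n ∈ {n | n ≥ 1} from hn) ⟨(s, n), rfl, rfl⟩

/-- The parameters on the base interval of the points which lie on ropes. -/
def ropeEnds : Set I := {s | s = 0 ∨ ∃ n, 1 ≤ n ∧ s = invNat n}

/-- The condition "on the base interval only at a rope end" respects the gluing, so it descends to a
predicate on `HR`; the generated equivalence relation need not be described. -/
theorem HR.pt_zero_mem_ropes {s : I} : HR.pt 0 s ∈ ropes ↔ s ∈ ropeEnds := by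
  constructor
  · let P : HR → Prop := HR.lift (fun n s => n = 0 → s ∈ ropeEnds)
      (fun n => by simp [ropeEnds]) (fun n hn => by
        have : n ≠ 0 := by omega
        simp only [this, false_imp_iff, eq_iff_iff, true_iff]
        exact fun _ => Or.inr ⟨n, hn, rfl⟩)
    have hP : ∀ x ∈ ropes, P x := by
      intro x hx
      simp only [ropes, Set.mem_iUnion] at hx
      obtain ⟨n, hn, ⟨s, m⟩, hm, rfl⟩ := hx
      change m = 0 → _
      simp only [Set.mem_ofPred_eq] at hm
      omega
    exact fun h => hP _ h rfl
  · rintro (rfl | ⟨n, hn, rfl⟩)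
    · rw [← HR.pt_zero 1]
      exact HR.pt_mem_ropes le_rfl 0
    · rw [← HR.pt_one hn]
      exact HR.pt_mem_ropes hn 1

theorem isClosed_ropeEnds : IsClosed ropeEnds := by
  -- A convergent sequence together with its limit is compact.
  have hK : IsCompact (insert (0 : ℝ) (Set.range fun n : ℕ => 1 / ((n : ℝ) + 1))) :=
    tendsto_one_div_add_atTop_nhds_zero_nat.isCompact_insert_range
  convert hK.isClosed.preimage (continuous_subtype_val : Continuous (Subtype.val : I → ℝ))
  ext s
  simp only [ropeEnds, Set.mem_ofPred_eq, Set.mem_preimage, Set.mem_insert_iff, Set.mem_range]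
  refine or_congr (by simp) ⟨?_, ?_⟩
  · rintro ⟨n, hn, rfl⟩
    refine ⟨n - 1, ?_⟩
    simp [invNat, Nat.cast_sub hn]
  · rintro ⟨n, hn⟩
    exact ⟨n + 1, by omega, Subtype.ext (by simp [← hn, invNat])⟩

theorem isClosed_ropes : IsClosed ropes := by
  rw [← (isQuotientMap_quot_mk (r := RopeRel)).isClosed_preimage, ← isOpen_compl_iff,
    isOpen_prod_iff]
  intro s n h
  rcases Nat.eq_zero_or_pos n with rfl | hn
  · refine ⟨ropeEndsᶜ, {0}, isClosed_ropeEnds.isOpen_compl, isOpen_discrete _, ?_, rfl, ?_⟩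
    · exact fun hs => h (HR.pt_zero_mem_ropes.2 hs)
    · rintro ⟨s', n'⟩ ⟨h1, rfl⟩ h2
      exact h1 (HR.pt_zero_mem_ropes.1 h2)
  · exact absurd (HR.pt_mem_ropes hn s) h

theorem isConnected_ropes : IsConnected ropes := by
  refine ⟨⟨_, HR.pt_mem_ropes le_rfl 0⟩, isPreconnected_of_forall (HR.pt 0 0) ?_⟩
  intro y hy
  simp only [ropes, Set.mem_iUnion] at hy
  obtain ⟨n, hn, ⟨s, m⟩, hm, rfl⟩ := hy
  obtain rfl : m = n := hm
  refine ⟨Set.range (HR.pt m), ?_, ⟨0, HR.pt_zero m⟩, ⟨s, rfl⟩,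
    isPreconnected_range (HR.continuous_pt m)⟩
  rintro _ ⟨s, rfl⟩
  exact HR.pt_mem_ropes hn s

theorem isConnected_fiber_collapseMap {X : Type} [TopologicalSpace X] {A : Set X}
    (hA : IsConnected A) (q : Collapse A) : IsConnected (collapseMap A ⁻¹' {q}) := by
  induction q using Quotient.ind with
  | _ x =>
    have h : collapseMap A ⁻¹' {⟦x⟧} = {y | y = x ∨ (y ∈ A ∧ x ∈ A)} := by
      ext y
      exact Quotient.eq
    rw [h]
    by_cases hx : x ∈ A
    · convert hA using 1
      ext y
      simp only [hx, and_true, Set.mem_ofPred_eq, or_iff_right_iff_imp]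
      rintro rfl
      exact hx
    · simpa [hx] using isConnected_singleton (x := x)

/-- Local path connectedness passes to quotients, so the interval is the only input. -/
theorem locallyPathConnectedSpace_HR : LocallyPathConnectedSpace HR :=
  have : LocallyPathConnectedSpace I := (convex_Icc (0 : ℝ) 1).locallyPathConnectedSpace
  inferInstance

open CategoryTheory

/-! ### Covering spaces of the wedge of circles -/

namespace CircleWedge

/-- The complement of the midpoints of the circles. -/
def awayFromMid : Set CircleWedge :=
  {x | CircleWedge.lift (fun n s => n = 0 ∨ (s : ℝ) ≠ 1 / 2) True (by simp) (by simp)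
    (by norm_num) x}

/-- The complement of the base point. -/
def awayFromBase : Set CircleWedge :=
  {x | CircleWedge.lift (fun n s => n ≠ 0 ∧ (0 : ℝ) < s ∧ (s : ℝ) < 1) False (by simp) (by simp)
    (by simp) x}

theorem pt_mem_awayFromMid {n : ℕ} {s : I} : pt n s ∈ awayFromMid ↔ n = 0 ∨ (s : ℝ) ≠ 1 / 2 := by
  simp only [awayFromMid, Set.mem_ofPred_eq, lift_pt]

theorem pt_mem_awayFromBase {n : ℕ} {s : I} :
    pt n s ∈ awayFromBase ↔ n ≠ 0 ∧ (0 : ℝ) < s ∧ (s : ℝ) < 1 := by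
  simp only [awayFromBase, Set.mem_ofPred_eq, lift_pt]

theorem isOpen_awayFromMid : IsOpen awayFromMid := by
  refine isOpen_iff.2 fun n => ?_
  have : pt n ⁻¹' awayFromMid = {s : I | n = 0 ∨ (s : ℝ) ≠ 1 / 2} := by
    ext s
    exact pt_mem_awayFromMid
  rw [this]
  by_cases hn : n = 0
  · simp [hn]
  · simp only [hn, false_or]
    exact isOpen_ne.preimage continuous_subtype_val

theorem isOpen_awayFromBase : IsOpen awayFromBase := by
  refine isOpen_iff.2 fun n => ?_
  have : pt n ⁻¹' awayFromBase = {s : I | n ≠ 0 ∧ (0 : ℝ) < s ∧ (s : ℝ) < 1} := by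
    ext s
    exact pt_mem_awayFromBase
  rw [this]
  by_cases hn : n = 0
  · simp [hn]
  · simp only [ne_eq, hn, not_false_eq_true, true_and]
    exact isOpen_Ioo.preimage continuous_subtype_val

variable {G : Type*} [Group G] (a : ℕ → G)

/-- The transition function of the covering whose monodromy along the `n`-th circle is `a n`. -/
def transition : CircleWedge → G :=
  CircleWedge.lift (fun n s => if n ≠ 0 ∧ (1 / 2 : ℝ) < s ∧ (s : ℝ) < 1 then a n else 1) 1
    (by simp) (by intro n; rw [if_neg]; norm_num) (by simp)

theorem transition_pt (n : ℕ) (s : I) :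
    transition a (pt n s) = if n ≠ 0 ∧ (1 / 2 : ℝ) < s ∧ (s : ℝ) < 1 then a n else 1 :=
  lift_pt ..

/-- The overlap of the two charts is a disjoint union of open half circles, and the function is
constant on each. -/
theorem continuousOn_transition [TopologicalSpace G] :
    ContinuousOn (transition a) (awayFromMid ∩ awayFromBase) := by
  rw [continuousOn_open_iff (isOpen_awayFromMid.inter isOpen_awayFromBase)]
  intro T _
  refine isOpen_iff.2 fun n => ?_
  have : pt n ⁻¹' (awayFromMid ∩ awayFromBase ∩ transition a ⁻¹' T) =
      {s : I | (n ≠ 0 ∧ 1 ∈ T) ∧ (s : ℝ) ∈ Set.Ioo 0 (1 / 2)} ∪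
        {s : I | (n ≠ 0 ∧ a n ∈ T) ∧ (s : ℝ) ∈ Set.Ioo (1 / 2) 1} := by
    ext s
    simp only [Set.mem_preimage, Set.mem_inter_iff, pt_mem_awayFromMid, pt_mem_awayFromBase,
      transition_pt, Set.mem_union, Set.mem_ofPred_eq, Set.mem_Ioo]
    by_cases hn : n = 0
    · simp [hn]
    · rcases lt_trichotomy (s : ℝ) (1 / 2) with h | h | h
      · have h1 : (s : ℝ) < 1 := by linarith
        simp [hn, h, h.not_gt, h.ne, h1, and_comm, -one_div]
      · simp only [hn, h]
        norm_num
      · have h0 : (0 : ℝ) < s := by linarith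
        by_cases h1 : (s : ℝ) < 1 <;> simp [hn, h, h.ne', h.not_gt, h0, h1, -one_div]
  rw [this]
  refine IsOpen.union ?_ ?_ <;>
  exact isOpen_const.inter (isOpen_Ioo.preimage continuous_subtype_val)

/-- The reading in the chart `i` of the sheet with label `1` over the complement of the base
point. -/
def chartFactor (i : Bool) (x : CircleWedge) : G := if i then transition a x else 1

open Classical in
/-- The covering of the wedge of circles with fibre `G`, whose monodromy along the `n`-th circle
is the left multiplication by `a n`. -/
def cover [TopologicalSpace G] [ContinuousMul G] [DiscreteTopology G] :
    FiberBundleCore Bool CircleWedge G where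
  baseSet i := if i then awayFromMid else awayFromBase
  isOpen_baseSet i := by
    cases i
    · simpa using isOpen_awayFromBase
    · simpa using isOpen_awayFromMid
  indexAt x := decide (x ∈ awayFromMid)
  mem_baseSet_at x := by
    by_cases hx : x ∈ awayFromMid
    · simp [hx]
    · obtain ⟨n, s, rfl⟩ := exists_pt x
      simp only [hx, decide_false, Bool.false_eq_true, if_false]
      rw [pt_mem_awayFromMid, not_or, not_not] at hx
      rw [pt_mem_awayFromBase, hx.2]
      exact ⟨hx.1, by norm_num, by norm_num⟩
  -- As a quotient of one factor per chart, the coordinate change satisfies the cocycle identity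
  -- automatically.
  coordChange i j x g := chartFactor a j x * (chartFactor a i x)⁻¹ * g
  coordChange_self i x _ v := by simp
  continuousOn_coordChange i j := by
    have h := (continuousOn_transition a).comp continuous_fst.continuousOn
      (s := (awayFromMid ∩ awayFromBase) ×ˢ (Set.univ : Set G)) (fun p hp => hp.1)
    have h' : ContinuousOn (fun p : CircleWedge × G => transition a p.1)
      ((awayFromBase ∩ awayFromMid) ×ˢ (Set.univ : Set G)) := by
      rwa [Set.inter_comm]
    have h2 : Continuous (fun p : CircleWedge × G => p.2) := continuous_snd
    have hinv : Continuous (fun g : G => g⁻¹) := continuous_of_discreteTopology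
    cases i <;> cases j
    · simp [chartFactor, h2.continuousOn]
    · have := h'.mul h2.continuousOn
      simpa [chartFactor, Pi.mul_def] using this
    · have := (hinv.comp_continuousOn h).mul h2.continuousOn
      simpa [chartFactor, Pi.mul_def] using this
    · simp [chartFactor, h2.continuousOn]
  coordChange_comp i j k x _ v := by group

/-- The `n`-th circle as a loop at the base point. -/
def loop (n : ℕ) : Path base base where
  toFun := pt n
  continuous_toFun := continuous_pt n
  source' := pt_zero n
  target' := pt_one n

variable [TopologicalSpace G] [ContinuousMul G] [DiscreteTopology G]

/-- The lift of the `n`-th circle to the covering. -/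
def coverLift (n : ℕ) (g : G) (s : I) : (cover a).TotalSpace :=
  ⟨pt n s, (if (s : ℝ) ≤ 1 / 2 then g else a n * g : G)⟩

/-- Off the midpoint, labels are read in the chart around the base point, where they are locally
constant. At the midpoint the other chart is used, and the transition function cancels the jump from
`g` to `a n * g`. -/
theorem continuous_coverLift {n : ℕ} (hn : n ≠ 0) (g : G) : Continuous (coverLift a n g) := by
  rw [continuous_iff_continuousAt]
  intro s
  rw [FiberBundle.continuousAt_totalSpace]
  refine ⟨(continuous_pt n).continuousAt, ?_⟩
  change ContinuousAt (fun x => (cover a).coordChange ((cover a).indexAt (pt n x))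
    ((cover a).indexAt (pt n s)) (pt n x) (if (x : ℝ) ≤ 1 / 2 then g else a n * g)) s
  rcases lt_trichotomy (s : ℝ) (1 / 2) with h | h | h
  · refine (continuousAt_const (y := g)).congr ?_
    filter_upwards [(isOpen_Iio.preimage continuous_subtype_val).mem_nhds h] with x hx
    replace hx : (x : ℝ) < 1 / 2 := hx
    simp only [cover, pt_mem_awayFromMid, h.ne, hx.ne, hx.le, ne_eq, not_false_eq_true, or_true,
      decide_true, if_true, mul_inv_cancel, one_mul]
  · refine (continuousAt_const (y := g)).congr ?_
    have h01 : (s : ℝ) ∈ Set.Ioo 0 1 := by rw [h]; norm_num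
    filter_upwards [(isOpen_Ioo.preimage continuous_subtype_val).mem_nhds h01] with x hx
    obtain ⟨hx0, hx1⟩ : (0 : ℝ) < x ∧ (x : ℝ) < 1 := hx
    simp only [cover, pt_mem_awayFromMid, h, hn, chartFactor, transition_pt, hx1]
    rcases lt_trichotomy (x : ℝ) (1 / 2) with h' | h' | h'
    · rw [if_pos h'.le]
      simp [h'.ne, h'.not_gt, -one_div]
    · simp [h']
    · rw [if_neg h'.not_ge]
      simp [h'.ne', h', hn, -one_div]
  · refine (continuousAt_const (y := a n * g)).congr ?_
    filter_upwards [(isOpen_Ioi.preimage continuous_subtype_val).mem_nhds h] with x hx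
    replace hx : 1 / 2 < (x : ℝ) := hx
    simp only [cover, pt_mem_awayFromMid, h.ne', hx.ne', hx.not_ge, ne_eq, not_false_eq_true,
      or_true, decide_true, if_false, mul_inv_cancel, one_mul]

theorem isCoveringMap_cover : IsCoveringMap (cover a).proj :=
  FiberBundle.isCoveringMap (F := G) (E := (cover a).Fiber)

/-- The point with label `g` over the base point. -/
def coverPt (g : G) : (cover a).proj ⁻¹' {base} := ⟨⟨base, g⟩, rfl⟩

theorem coverPt_injective : Function.Injective (coverPt a) := by
  intro g g' h
  have h1 : (⟨base, g⟩ : (cover a).TotalSpace) = ⟨base, g'⟩ := congrArg Subtype.val h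
  exact Bundle.TotalSpace.mk_injective (F := G) (E := (cover a).Fiber) base h1

/-- The class of the `n`-th circle in the fundamental group. -/
def loopClass (n : ℕ) : FundamentalGroup CircleWedge base :=
  FundamentalGroup.fromPath (Path.Homotopic.Quotient.mk (loop n))

theorem monodromy_loopClass {n : ℕ} (hn : n ≠ 0) (g : G) :
    (isCoveringMap_cover a).monodromyPerm base (loopClass n) (coverPt a g) =
      coverPt a (a n * g) := by
  rw [IsCoveringMap.coe_monodromyPerm]
  have h0 : coverLift a n g 0 = ⟨base, g⟩ := by
    simp only [coverLift, Set.Icc.coe_zero]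
    rw [if_pos (by norm_num)]
    exact congrArg (fun y => (⟨y, g⟩ : (cover a).TotalSpace)) (pt_zero n)
  have h1 : coverLift a n g 1 = ⟨base, (a n * g : G)⟩ := by
    simp only [coverLift, Set.Icc.coe_one]
    rw [if_neg (by norm_num)]
    exact congrArg (fun y => (⟨y, (a n * g : G)⟩ : (cover a).TotalSpace)) (pt_one n)
  refine (isCoveringMap_cover a).monodromy_eq_of_map_eq
    (Path.Homotopic.Quotient.mk ⟨⟨coverLift a n g, continuous_coverLift a hn g⟩, h0, h1⟩) ?_
  rfl

end CircleWedge

open CircleWedge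

/-- The homomorphism from the free group sending the `n`-th generator to the circle number
`n + 1`. -/
def wedgeHom : FreeGroup ℕ →* FundamentalGroup CircleWedge base :=
  FreeGroup.lift fun n => loopClass (n + 1)

/-- In the covering with fibre the free group, the monodromy of a word `w` is left multiplication by
`w`. A word in the kernel therefore fixes the label `1`, which forces `w = 1`. -/
theorem wedgeHom_injective : Function.Injective wedgeHom := by
  let _ : TopologicalSpace (FreeGroup ℕ) := ⊥
  have : DiscreteTopology (FreeGroup ℕ) := ⟨rfl⟩
  -- Circles are numbered from `1` and generators from `0`; the value at `0` never enters
  -- `transition`.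
  let a : ℕ → FreeGroup ℕ := fun n => FreeGroup.of (n - 1)
  have key : ∀ w g : FreeGroup ℕ, (isCoveringMap_cover a).monodromyPerm base (wedgeHom w)
      (coverPt a g) = coverPt a (w * g) := by
    intro w
    induction w using FreeGroup.induction_on with
    | C1 => intro g; rw [map_one, map_one, Equiv.Perm.one_apply, one_mul]
    | of n =>
      intro g
      have := monodromy_loopClass a n.succ_ne_zero g
      simpa [wedgeHom, a] using this
    | inv_of n _ =>
      intro g
      rw [map_inv, map_inv, Equiv.Perm.inv_eq_iff_eq]
      have h := monodromy_loopClass a n.succ_ne_zero ((FreeGroup.of n)⁻¹ * g)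
      rw [show a n.succ * ((FreeGroup.of n)⁻¹ * g) = g from mul_inv_cancel_left _ _] at h
      rw [← h]
      simp [wedgeHom]
    | mul x y hx hy =>
      intro g
      rw [map_mul, map_mul, Equiv.Perm.mul_apply, hy, hx, mul_assoc]
  rw [injective_iff_map_eq_one]
  intro w hw
  have := key w 1
  rw [hw, map_one, Equiv.Perm.one_apply, mul_one] at this
  exact (coverPt_injective a this).symm

/-! ### The fundamental group of the wedge is generated by the circles -/

instance : ContractibleSpace I := (convex_Icc (0 : ℝ) 1).contractibleSpace ⟨0, by simp⟩

/-- The homotopy class of a path, as an arrow of the fundamental groupoid. -/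
def pathClass {X : Type*} [TopologicalSpace X] {x y : X} (γ : Path x y) :
    FundamentalGroupoid.mk x ⟶ FundamentalGroupoid.mk y :=
  Path.Homotopic.Quotient.mk γ

theorem pathClass_trans {X : Type*} [TopologicalSpace X] {x y z : X} (γ : Path x y)
    (γ' : Path y z) : pathClass (γ.trans γ') = pathClass γ ≫ pathClass γ' := rfl

theorem pathClass_refl {X : Type*} [TopologicalSpace X] (x : X) :
    pathClass (Path.refl x) = 𝟙 (FundamentalGroupoid.mk x) := rfl

theorem pathClass_eq_iff {X : Type*} [TopologicalSpace X] {x y : X} {γ γ' : Path x y} :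
    pathClass γ = pathClass γ' ↔ γ.Homotopic γ' :=
  Path.Homotopic.Quotient.eq

/-- The ends `pt n 0` and `pt n 1` equal `base` only propositionally; the discrepancy is carried by
`eqToHom`. -/
theorem pathClass_cast {X : Type*} [TopologicalSpace X] {x y x' y' : X} (γ : Path x y)
    (hx : x' = x) (hy : y' = y) : pathClass (γ.cast hx hy) =
      eqToHom congr(FundamentalGroupoid.mk $hx) ≫ pathClass γ ≫
        eqToHom congr(FundamentalGroupoid.mk $hy.symm) := by
  subst hx hy
  simp

namespace CircleWedge

theorem base_eq_pt_zero (n : ℕ) : base = pt n 0 := (pt_zero n).symm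

theorem base_eq_pt_one (n : ℕ) : base = pt n 1 := (pt_one n).symm

theorem pt_eq_pt {n : ℕ} (hn : n ≠ 0) {s : I} (h0 : 0 < s) (h1 : s < 1) {m : ℕ} {t : I}
    (h : pt m t = pt n s) : m = n ∧ t = s := by
  let P : CircleWedge → Prop :=
    CircleWedge.lift (fun m t => m = n ∧ t = s) False (by simp [hn.symm]) (by simp [h0.ne])
      (by simp [h1.ne'])
  have hP : P (pt n s) := by simp only [P, lift_pt, and_self]
  rw [← h] at hP
  simpa only [P, lift_pt] using hP

theorem pt_eq_base {n : ℕ} (hn : n ≠ 0) {s : I} (h : pt n s = base) : s = 0 ∨ s = 1 := by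
  by_contra! hs
  have := pt_eq_pt (m := 0) (t := 0) hn (bot_lt_iff_ne_bot.2 hs.1 : 0 < s)
    (lt_top_iff_ne_top.2 hs.2 : s < 1) (by rw [h, pt_zero_left])
  exact hn this.1.symm

/-- The class of the arcs from `s` to `t` on the `n`-th circle. -/
def arc (n : ℕ) (s t : I) :
    FundamentalGroupoid.mk (pt n s) ⟶ FundamentalGroupoid.mk (pt n t) :=
  pathClass ((PathConnectedSpace.somePath s t).map (continuous_pt n))

/-- The interval is simply connected, so the chosen path in the definition of `arc` is immaterial.
-/
theorem pathClass_map_pt (n : ℕ) {s t : I} (c : Path s t) :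
    pathClass (c.map (continuous_pt n)) = arc n s t :=
  pathClass_eq_iff.2
    ((SimplyConnectedSpace.paths_homotopic c _).map ⟨pt n, continuous_pt n⟩)

theorem arc_comp (n : ℕ) (s t r : I) : arc n s t ≫ arc n t r = arc n s r := by
  rw [arc, arc, ← pathClass_trans, ← Path.map_trans, pathClass_map_pt]

theorem arc_comp_assoc (n : ℕ) (s t r : I) {x : FundamentalGroupoid CircleWedge}
    (f : FundamentalGroupoid.mk (pt n r) ⟶ x) :
    arc n s t ≫ arc n t r ≫ f = arc n s r ≫ f := by
  rw [← Category.assoc, arc_comp]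

theorem arc_self (n : ℕ) (s : I) : arc n s s = 𝟙 _ :=
  (pathClass_map_pt n (Path.refl s)).symm

theorem inv_arc (n : ℕ) (s t : I) : inv (arc n s t) = arc n t s := by
  rw [IsIso.inv_eq_of_hom_inv_id]
  rw [arc_comp, arc_self]

theorem loopClass_eq (n : ℕ) : loopClass n =
    eqToHom congr(FundamentalGroupoid.mk $(base_eq_pt_zero n)) ≫ arc n 0 1 ≫
      eqToHom congr(FundamentalGroupoid.mk $(pt_one n)) := by
  rw [← pathClass_map_pt n (⟨⟨id, continuous_id⟩, rfl, rfl⟩ : Path (0 : I) 1),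
    ← pathClass_cast _ (base_eq_pt_zero n) (base_eq_pt_one n)]
  rfl

/-! ### Words, and arrows running along one circle -/

/-- The subset of the fundamental group generated by the circles. -/
def IsWord (f : FundamentalGroupoid.mk base ⟶ FundamentalGroupoid.mk base) : Prop :=
  f ∈ wedgeHom.range

theorem IsWord.comp {f g : FundamentalGroupoid.mk base ⟶ FundamentalGroupoid.mk base}
    (hf : IsWord f) (hg : IsWord g) : IsWord (f ≫ g) :=
  -- Multiplication in the fundamental group is composition in the opposite order.
  wedgeHom.range.mul_mem hg hf

theorem IsWord.inv {f : FundamentalGroupoid.mk base ⟶ FundamentalGroupoid.mk base}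
    (hf : IsWord f) : IsWord (CategoryTheory.inv f) := by
  have := wedgeHom.range.inv_mem hf
  rwa [IsWord, ← Groupoid.inv_eq_inv]

theorem isWord_id : IsWord (𝟙 _) := wedgeHom.range.one_mem

theorem isWord_loopClass (n : ℕ) : IsWord (loopClass (n + 1)) :=
  ⟨FreeGroup.of n, by simp [wedgeHom]⟩

/-- The arcs between points of a circle which represent the base point are words. -/
theorem isWord_arc (n : ℕ) {s t : I} (hs : base = pt (n + 1) s) (ht : pt (n + 1) t = base) :
    IsWord (eqToHom congr(FundamentalGroupoid.mk $hs) ≫ arc (n + 1) s t ≫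
      eqToHom congr(FundamentalGroupoid.mk $ht)) := by
  rcases pt_eq_base n.succ_ne_zero hs.symm with rfl | rfl <;>
  rcases pt_eq_base n.succ_ne_zero ht with rfl | rfl
  · rw [arc_self]
    simpa using isWord_id
  · have := isWord_loopClass n
    rwa [loopClass_eq] at this
  · have := (isWord_loopClass n).inv
    rw [loopClass_eq] at this
    simpa [inv_arc] using this
  · rw [arc_self]
    simpa using isWord_id

/-- The arrows from the base point which run along one circle. -/
def IsNice {y : CircleWedge} (f : FundamentalGroupoid.mk base ⟶ FundamentalGroupoid.mk y) : Prop :=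
  ∃ (n : ℕ) (e s : I) (he : base = pt (n + 1) e) (hs : pt (n + 1) s = y),
    f = eqToHom congr(FundamentalGroupoid.mk $he) ≫ arc (n + 1) e s ≫
      eqToHom congr(FundamentalGroupoid.mk $hs)

theorem IsNice.isWord {f : FundamentalGroupoid.mk base ⟶ FundamentalGroupoid.mk base}
    (hf : IsNice f) : IsWord f := by
  obtain ⟨n, e, s, he, hs, rfl⟩ := hf
  exact isWord_arc n he hs

/-- Over the base point both arrows are words. Any other point is interior to a unique circle, so
both arrows run along that circle, and the composite is an arc between two of its ends. -/
theorem IsNice.comp_inv {y : CircleWedge}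
    {f g : FundamentalGroupoid.mk base ⟶ FundamentalGroupoid.mk y} (hf : IsNice f)
    (hg : IsNice g) : IsWord (f ≫ CategoryTheory.inv g) := by
  by_cases hy : y = base
  · subst hy
    exact hf.isWord.comp hg.isWord.inv
  · obtain ⟨n, e, s, he, hs, rfl⟩ := hf
    obtain ⟨m, e', s', he', hs', rfl⟩ := hg
    subst hs
    have h0 : 0 < s := by
      rw [← show ((⊥ : I) = 0) from rfl, bot_lt_iff_ne_bot]
      rintro rfl
      exact hy (pt_zero _)
    have h1 : s < 1 := by
      rw [← show ((⊤ : I) = 1) from rfl, lt_top_iff_ne_top]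
      rintro rfl
      exact hy (pt_one _)
    obtain ⟨h2, rfl⟩ := pt_eq_pt n.succ_ne_zero h0 h1 hs'
    obtain rfl : m = n := by omega
    have := isWord_arc m he he'.symm
    simpa [inv_arc, arc_comp_assoc] using this

/-- The arrows which become words after composition with arrows along a circle. -/
def IsGood {x y : CircleWedge} (f : FundamentalGroupoid.mk x ⟶ FundamentalGroupoid.mk y) : Prop :=
  ∃ (p : FundamentalGroupoid.mk base ⟶ FundamentalGroupoid.mk x)
    (q : FundamentalGroupoid.mk base ⟶ FundamentalGroupoid.mk y),
    IsNice p ∧ IsNice q ∧ IsWord (p ≫ f ≫ inv q)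

/-- The auxiliary arrows chosen at the common point `y` differ by a word, by `IsNice.comp_inv`, so
inserting them between the factors does no harm. -/
theorem IsGood.comp {x y z : CircleWedge}
    {f : FundamentalGroupoid.mk x ⟶ FundamentalGroupoid.mk y}
    {g : FundamentalGroupoid.mk y ⟶ FundamentalGroupoid.mk z} (hf : IsGood f) (hg : IsGood g) :
    IsGood (f ≫ g) := by
  obtain ⟨p, q, hp, hq, h⟩ := hf
  obtain ⟨p', q', hp', hq', h'⟩ := hg
  refine ⟨p, q', hp, hq', ?_⟩
  simpa using (h.comp (hq.comp_inv hp')).comp h'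

theorem isGood_of_cast {x y x' y' : CircleWedge} (γ : Path x y) (hx : x' = x) (hy : y' = y)
    (h : IsGood (pathClass (γ.cast hx hy))) : IsGood (pathClass γ) := by
  subst hx hy
  exact h

theorem IsGood.isWord {f : FundamentalGroupoid.mk base ⟶ FundamentalGroupoid.mk base}
    (hf : IsGood f) : IsWord f := by
  obtain ⟨p, q, hp, hq, h⟩ := hf
  simpa using (hp.isWord.inv.comp h).comp hq.isWord

theorem isGood_arc (n : ℕ) (s t : I) : IsGood (arc (n + 1) s t) := by
  refine ⟨eqToHom congr(FundamentalGroupoid.mk $(base_eq_pt_zero (n + 1))) ≫ arc (n + 1) 0 s,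
    eqToHom congr(FundamentalGroupoid.mk $(base_eq_pt_zero (n + 1))) ≫ arc (n + 1) 0 t,
    ⟨n, 0, s, base_eq_pt_zero _, rfl, by simp⟩, ⟨n, 0, t, base_eq_pt_zero _, rfl, by simp⟩, ?_⟩
  simpa [inv_arc, arc_comp_assoc, arc_self] using isWord_id

theorem exists_succ_pt (x : CircleWedge) : ∃ n s, pt (n + 1) s = x := by
  obtain ⟨n, s, rfl⟩ := exists_pt x
  cases n with
  | zero => exact ⟨0, 0, by rw [pt_zero, pt_zero_left]⟩
  | succ n => exact ⟨n, s, rfl⟩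

/-! ### Contracting a neighbourhood of the base point -/

/-- Stretch the interval, so that the two outer thirds go to the ends. -/
def stretch (s : I) : I := Set.projIcc 0 1 zero_le_one (3 * s - 1)

theorem continuous_stretch : Continuous stretch := continuous_projIcc.comp (by fun_prop)

theorem stretch_zero : stretch 0 = 0 := Set.projIcc_of_le_left _ (by norm_num)

theorem stretch_one : stretch 1 = 1 := Set.projIcc_of_right_le _ (by norm_num)

theorem pt_convexComb_zero (n : ℕ) (t : I) :
    pt n (Set.Icc.convexComb 0 (stretch 0) t) = base := by
  rw [stretch_zero]
  convert pt_zero n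
  simp

theorem pt_convexComb_one (n : ℕ) (t : I) :
    pt n (Set.Icc.convexComb 1 (stretch 1) t) = base := by
  rw [stretch_one]
  convert pt_one n
  simp

/-- Stretch each circle of the wedge. -/
def stretchMap : C(CircleWedge, CircleWedge) where
  toFun := CircleWedge.lift (fun n s => pt n (stretch s)) base (fun s => pt_zero_left _)
    (fun n => by rw [stretch_zero, pt_zero]) (fun n => by rw [stretch_one, pt_one])
  continuous_toFun := continuous_of_pt' fun n => by
    simp only [lift_pt]
    exact (continuous_pt n).comp continuous_stretch

theorem stretchMap_pt (n : ℕ) (s : I) : stretchMap (pt n s) = pt n (stretch s) :=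
  lift_pt (fun n s => pt n (stretch s)) base (fun _ => pt_zero_left _)
    (fun n => by rw [stretch_zero, pt_zero]) (fun n => by rw [stretch_one, pt_one]) n s

/-- The homotopy between the identity and `stretchMap`. -/
def stretchHomotopy : (ContinuousMap.id CircleWedge).Homotopy stretchMap where
  toFun p := CircleWedge.lift (fun n s => pt n (Set.Icc.convexComb s (stretch s) p.1)) base
    (fun s => pt_zero_left _) (fun n => pt_convexComb_zero n p.1)
    (fun n => pt_convexComb_one n p.1) p.2
  continuous_toFun := by
    refine Continuous.comp (g := fun q : CircleWedge × I => CircleWedge.lift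
      (fun n s => pt n (Set.Icc.convexComb s (stretch s) q.2)) base
      (fun s => pt_zero_left _) (fun n => pt_convexComb_zero n q.2)
      (fun n => pt_convexComb_one n q.2) q.1) (continuous_of_pt ?_) continuous_swap
    intro n
    simp only [lift_pt]
    have := continuous_stretch
    exact (continuous_pt n).comp (by fun_prop)
  map_zero_left x := by
    obtain ⟨n, s, rfl⟩ := exists_pt x
    simp only [lift_pt, Set.Icc.convexComb_zero, ContinuousMap.id_apply]
  map_one_left x := by
    obtain ⟨n, s, rfl⟩ := exists_pt x
    simp only [lift_pt, Set.Icc.convexComb_one, stretchMap_pt]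

theorem stretchHomotopy_pt (n : ℕ) (s t : I) :
    stretchHomotopy (t, pt n s) = pt n (Set.Icc.convexComb s (stretch s) t) :=
  lift_pt (fun n s => pt n (Set.Icc.convexComb s (stretch s) t)) base (fun _ => pt_zero_left _)
    (fun n => pt_convexComb_zero n t) (fun n => pt_convexComb_one n t) n s

/-- The path from a point close to the base point to the base point. -/
def stretchPath {x : CircleWedge} (h : stretchMap x = base) : Path x base where
  toFun t := stretchHomotopy (t, x)
  continuous_toFun := by fun_prop
  source' := stretchHomotopy.apply_zero x
  target' := (stretchHomotopy.apply_one x).trans h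

/-- The trace of the homotopy at `x` stays on the circle of `x` and leads to one of its ends. -/
theorem isNice_of_stretchMap_eq_base {x : CircleWedge} (h : stretchMap x = base) :
    IsNice (inv (pathClass (stretchPath h))) := by
  obtain ⟨n, s, rfl⟩ := exists_succ_pt x
  have h' : base = pt (n + 1) (stretch s) := by rw [← h, stretchMap_pt]
  refine ⟨n, stretch s, s, h', rfl, ?_⟩
  let c : Path s (stretch s) := ⟨⟨Set.Icc.convexComb s (stretch s), by fun_prop⟩, by simp, by simp⟩
  have h2 : stretchPath h = (c.map (continuous_pt (n + 1))).cast rfl h' := by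
    ext t
    exact stretchHomotopy_pt (n + 1) s t
  rw [h2, pathClass_cast _ rfl h', pathClass_map_pt]
  simp [inv_arc]

/-- Naturality of the homotopy along `γ` gives a square whose fourth side, `stretchMap ∘ γ`, is
constant. -/
theorem trans_stretchPath {x y : CircleWedge} (γ : Path x y) (hx : stretchMap x = base)
    (hy : stretchMap y = base) (h : ∀ t, stretchMap (γ t) = base) :
    pathClass γ ≫ pathClass (stretchPath hy) = pathClass (stretchPath hx) := by
  rw [← Category.comp_id (pathClass (stretchPath hx)), ← pathClass_refl, ← pathClass_trans,
    ← pathClass_trans, pathClass_eq_iff]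
  have key := (Path.Homotopic.map_trans_evalAt stretchHomotopy γ).pathCast
    (show x = ContinuousMap.id _ x from rfl) hy.symm
  convert key using 1
  · ext t
    simp only [Path.trans_apply, Path.cast_coe]
    split_ifs <;> rfl
  · ext t
    simp only [Path.trans_apply, Path.cast_coe, Path.map_coe, Function.comp_apply, h]
    split_ifs <;> rfl

/-- A path which stays close to the base point is good. -/
theorem isGood_of_stretchMap {x y : CircleWedge} (γ : Path x y)
    (h : ∀ t, stretchMap (γ t) = base) : IsGood (pathClass γ) := by
  have hx : stretchMap x = base := by simpa using h 0
  have hy : stretchMap y = base := by simpa using h 1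
  refine ⟨_, _, isNice_of_stretchMap_eq_base hx, isNice_of_stretchMap_eq_base hy, ?_⟩
  rw [IsIso.inv_inv, trans_stretchPath γ hx hy h, IsIso.inv_hom_id]
  exact isWord_id

/-- This makes the parameter of a path inside an open arc continuous, so that the path comes from
the interval. -/
theorem isOpenEmbedding_arc (n : ℕ) :
    Topology.IsOpenEmbedding fun s : Set.Ioo (0 : I) 1 => pt (n + 1) s := by
  refine .of_continuous_injective_isOpenMap ((continuous_pt _).comp continuous_subtype_val) ?_ ?_
  · intro s t hst
    exact Subtype.ext (pt_eq_pt n.succ_ne_zero t.2.1 t.2.2 hst).2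
  · intro W hW
    refine isOpen_iff.2 fun m => ?_
    by_cases hm : m = n + 1
    · subst hm
      convert (isOpen_Ioo.isOpenMap_subtype_val) W hW using 1
      ext1 s
      constructor
      · rintro ⟨t, ht, hts⟩
        exact ⟨t, ht, (pt_eq_pt n.succ_ne_zero t.2.1 t.2.2 hts.symm).2.symm⟩
      · rintro ⟨t, ht, rfl⟩
        exact ⟨t, ht, rfl⟩
    · convert isOpen_empty
      rw [Set.eq_empty_iff_forall_notMem]
      rintro s ⟨t, ht, hts⟩
      exact hm (pt_eq_pt n.succ_ne_zero t.2.1 t.2.2 hts.symm).1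

/-- A path in one of the open arcs is good. -/
theorem isGood_of_mem_arc {x y : CircleWedge} (γ : Path x y) (n : ℕ)
    (h : ∀ t, ∃ s : I, 0 < s ∧ s < 1 ∧ pt (n + 1) s = γ t) : IsGood (pathClass γ) := by
  choose c h0 h1 hc using h
  have hcont : Continuous fun t => (⟨c t, h0 t, h1 t⟩ : Set.Ioo (0 : I) 1) := by
    rw [(isOpenEmbedding_arc n).continuous_iff]
    exact γ.continuous.congr fun t => (hc t).symm
  have hx : x = pt (n + 1) (c 0) := by rw [hc, γ.source]
  have hy : y = pt (n + 1) (c 1) := by rw [hc, γ.target]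
  let τ : Path (c 0) (c 1) := ⟨⟨c, continuous_subtype_val.comp hcont⟩, rfl, rfl⟩
  have hγ : γ = (τ.map (continuous_pt (n + 1))).cast hx hy := by
    ext t
    exact (hc t).symm
  subst hx hy
  rw [hγ]
  exact (pathClass_map_pt (n + 1) τ) ▸ isGood_arc n (c 0) (c 1)

theorem isOpen_arc (n : ℕ) : IsOpen (pt (n + 1) '' Set.Ioo 0 1) := by
  have := (isOpenEmbedding_arc n).isOpen_range
  rwa [Set.range_comp' (pt (n + 1)), Subtype.range_coe] at this

/-! ### Subdivision of loops -/

/-- The complement of the middle thirds of the circles. -/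
def awayFromMiddle : Set CircleWedge :=
  {x | CircleWedge.lift (fun n s => n = 0 ∨ (s : ℝ) < 1 / 3 ∨ (2 / 3 : ℝ) < s) True (by simp)
    (by norm_num) (by norm_num) x}

theorem pt_mem_awayFromMiddle {n : ℕ} {s : I} :
    pt n s ∈ awayFromMiddle ↔ n = 0 ∨ (s : ℝ) < 1 / 3 ∨ (2 / 3 : ℝ) < s := by
  simp only [awayFromMiddle, Set.mem_ofPred_eq, lift_pt]

theorem isOpen_awayFromMiddle : IsOpen awayFromMiddle := by
  refine isOpen_iff.2 fun n => ?_
  have : pt n ⁻¹' awayFromMiddle =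
      {s : I | n = 0} ∪ ({s : I | (s : ℝ) < 1 / 3} ∪ {s : I | (2 / 3 : ℝ) < s}) := by
    ext s
    exact pt_mem_awayFromMiddle
  rw [this]
  exact isOpen_const.union ((isOpen_Iio.preimage continuous_subtype_val).union
    (isOpen_Ioi.preimage continuous_subtype_val))

theorem stretchMap_eq_base {x : CircleWedge} (hx : x ∈ awayFromMiddle) : stretchMap x = base := by
  obtain ⟨n, s, rfl⟩ := exists_pt x
  rw [stretchMap_pt]
  rcases pt_mem_awayFromMiddle.1 hx with rfl | h | h
  · exact pt_zero_left _
  · rw [stretch, Set.projIcc_of_le_left _ (by linarith)]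
    exact pt_zero n
  · rw [stretch, Set.projIcc_of_right_le _ (by linarith)]
    exact pt_one n

theorem mem_awayFromMiddle_or (x : CircleWedge) :
    x ∈ awayFromMiddle ∨ ∃ n, x ∈ pt (n + 1) '' Set.Ioo 0 1 := by
  obtain ⟨n, s, rfl⟩ := exists_succ_pt x
  by_cases h : pt (n + 1) s ∈ awayFromMiddle
  · exact Or.inl h
  · rw [pt_mem_awayFromMiddle] at h
    push Not at h
    refine Or.inr ⟨n, s, ⟨?_, ?_⟩, rfl⟩
    · rw [← Subtype.coe_lt_coe, Set.Icc.coe_zero]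
      linarith
    · rw [← Subtype.coe_lt_coe, Set.Icc.coe_one]
      linarith

/-- By compactness the loop is cut into finitely many pieces, each close to the base point or inside
one open arc. Both kinds are good, and good arrows compose. -/
theorem isGood_pathClass (γ : Path base base) : IsGood (pathClass γ) := by
  -- Index `0` is the neighbourhood of the base point, index `n + 1` the open arc of circle `n + 1`.
  let V : ℕ → Set I := fun n => n.rec
    {t | γ t ∈ awayFromMiddle} (fun n _ => {t | γ t ∈ pt (n + 1) '' Set.Ioo 0 1})
  obtain ⟨t, ht0, ht, ⟨N, hN⟩, hV⟩ := exists_monotone_Icc_subset_open_cover_unitInterval (c := V)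
    (by
      rintro (_ | n)
      · exact isOpen_awayFromMiddle.preimage γ.continuous
      · exact (isOpen_arc n).preimage γ.continuous)
    (by
      intro t _
      rcases mem_awayFromMiddle_or (γ t) with h | ⟨n, h⟩
      · exact Set.mem_iUnion.2 ⟨0, h⟩
      · exact Set.mem_iUnion.2 ⟨n + 1, h⟩)
  have hgood : ∀ n, IsGood (pathClass (γ.subpath (t n) (t (n + 1)))) := by
    intro n
    have hmem : ∀ r, ∃ r' ∈ Set.Icc (t n) (t (n + 1)),
        γ r' = γ.subpath (t n) (t (n + 1)) r := by
      intro r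
      have := Set.mem_range_self (f := γ.subpath (t n) (t (n + 1))) r
      rwa [γ.range_subpath_of_le _ _ (ht n.le_succ)] at this
    obtain ⟨i, hi⟩ := hV n
    cases i with
    | zero =>
      refine isGood_of_stretchMap _ fun r => ?_
      obtain ⟨r', hr', h⟩ := hmem r
      rw [← h]
      exact stretchMap_eq_base (hi hr')
    | succ m =>
      refine isGood_of_mem_arc _ m fun r => ?_
      obtain ⟨r', hr', h⟩ := hmem r
      rw [← h]
      obtain ⟨s, hs, hs'⟩ := hi hr'
      exact ⟨s, hs.1, hs.2, hs'⟩
  have hind : ∀ n, IsGood (pathClass (γ.subpath (t 0) (t n))) := by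
    intro n
    induction n with
    | zero =>
      rw [Path.subpath_self]
      refine isGood_of_stretchMap _ fun r => ?_
      rw [ht0]
      change stretchMap (γ 0) = base
      rw [γ.source, base_eq_pt_zero 0, stretchMap_pt, stretch_zero]
    | succ n ih =>
      have := pathClass_eq_iff.2 ⟨Path.Homotopy.subpathTransSubpath γ (t 0) (t n) (t (n + 1))⟩
      rw [← this, pathClass_trans]
      exact ih.comp (hgood n)
  have := hind N
  rw [ht0, hN N le_rfl, Path.subpath_zero_one] at this
  exact isGood_of_cast γ γ.source γ.target this

theorem isWord_pathClass (γ : Path base base) : IsWord (pathClass γ) :=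
  (isGood_pathClass γ).isWord

theorem wedgeHom_surjective : Function.Surjective wedgeHom := by
  intro x
  obtain ⟨γ, rfl⟩ := Path.Homotopic.Quotient.mk_surjective x
  exact isWord_pathClass γ

end CircleWedge

/-! ### The quotient by the ropes is the Hawaiian earring -/

/-- The parametrization with period `1` of the `n`-th circle of the earring. -/
def circ (n : ℕ) (u : ℝ) : ℝ × ℝ :=
  (1 - 1 / (2 * (n : ℝ)) * (1 - Real.cos (2 * Real.pi * u)),
    1 / (2 * (n : ℝ)) * Real.sin (2 * Real.pi * u))

theorem continuous_circ (n : ℕ) : Continuous (circ n) := by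
  unfold circ
  fun_prop

theorem circ_add_int (n : ℕ) (u : ℝ) (k : ℤ) : circ n (u + k) = circ n u := by
  have h : 2 * Real.pi * (u + k) = 2 * Real.pi * u + k * (2 * Real.pi) := by ring
  rw [circ, circ, h, Real.cos_add_int_mul_two_pi, Real.sin_add_int_mul_two_pi]

theorem circ_zero (n : ℕ) : circ n 0 = (1, 0) := by
  simp [circ]

theorem circ_int (n : ℕ) (k : ℤ) : circ n k = (1, 0) := by
  rw [← circ_zero n, ← circ_add_int n 0 k, zero_add]

theorem circ_natCast (n k : ℕ) : circ n k = (1, 0) := by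
  exact_mod_cast circ_int n k

theorem circ_fract (n : ℕ) (u : ℝ) : circ n (Int.fract u) = circ n u := by
  rw [← circ_add_int n (Int.fract u) ⌊u⌋, Int.fract_add_floor]

theorem base_mem_earring : ((1, 0) : ℝ × ℝ) ∈ earring :=
  ⟨1, le_rfl, by norm_num⟩

theorem circ_mem_earring (n : ℕ) (u : ℝ) : circ n u ∈ earring := by
  rcases Nat.eq_zero_or_pos n with rfl | hn
  · have : circ 0 u = (1, 0) := by simp [circ]
    rw [this]
    exact base_mem_earring
  · refine ⟨n, hn, ?_⟩
    simp only [circ]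
    linear_combination (1 / (2 * (n : ℝ))) ^ 2 * Real.sin_sq_add_cos_sq (2 * Real.pi * u)

theorem exists_circ_eq {p : ℝ × ℝ} (hp : p ∈ earring) : ∃ n u, 1 ≤ n ∧ circ n u = p := by
  obtain ⟨n, hn, h⟩ := hp
  have hn' : (n : ℝ) ≠ 0 := by positivity
  obtain ⟨x, y⟩ := p
  simp only at h
  -- The similarity taking the `n`-th circle to the unit circle and `(1, 0)` to `1`; the argument of
  -- `z` is then the parameter.
  set z : ℂ := ⟨2 * n * (x - 1) + 1, 2 * n * y⟩ with hz
  have hz1 : ‖z‖ = 1 := by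
    rw [← sq_eq_sq₀ (norm_nonneg z) zero_le_one, Complex.sq_norm, Complex.normSq_apply]
    field_simp at h
    simp only [hz]
    linear_combination h
  have hz0 : z ≠ 0 := by
    rw [← norm_ne_zero_iff, hz1]
    exact one_ne_zero
  refine ⟨n, z.arg / (2 * Real.pi), hn, ?_⟩
  rw [circ, mul_div_cancel₀ _ (by positivity), Complex.cos_arg hz0, Complex.sin_arg, hz1]
  ext
  · simp only [hz]
    field_simp
    ring
  · simp only [hz]
    field_simp

theorem circ_eq_base {n : ℕ} (hn : 1 ≤ n) {u : ℝ} (h : circ n u = (1, 0)) : ∃ k : ℤ, u = k := by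
  have hn' : (n : ℝ) ≠ 0 := by positivity
  have h1 : Real.cos (2 * Real.pi * u) = 1 := by
    have := congrArg Prod.fst h
    simp only [circ] at this
    field_simp at this
    linarith
  obtain ⟨k, hk⟩ := (Real.cos_eq_one_iff _).1 h1
  refine ⟨k, ?_⟩
  have := Real.pi_pos
  field_simp at hk
  linarith

theorem circ_eq_circ {n m : ℕ} (hn : 1 ≤ n) (hm : 1 ≤ m) {u v : ℝ} (h : circ n u = circ m v)
    (h0 : circ n u ≠ (1, 0)) : n = m ∧ ∃ k : ℤ, u - v = k := by
  -- The equation of the circle, solved for `n`: away from `(1, 0)` the point determines its circle.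
  have key : ∀ (n : ℕ) (u : ℝ), 1 ≤ n → n * ((1 - (circ n u).1) ^ 2 + (circ n u).2 ^ 2) =
      1 - (circ n u).1 := by
    intro n u hn
    have hn' : (n : ℝ) ≠ 0 := by positivity
    simp only [circ]
    field_simp
    linear_combination Real.sin_sq_add_cos_sq (2 * Real.pi * u)
  have h1 := key n u hn
  have h2 := key m v hm
  rw [← h] at h2
  have h3 : ((n : ℝ) - m) * ((1 - (circ n u).1) ^ 2 + (circ n u).2 ^ 2) = 0 := by linarith
  obtain rfl : n = m := by
    rcases mul_eq_zero.1 h3 with h4 | h4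
    · exact_mod_cast sub_eq_zero.1 h4
    · exfalso
      apply h0
      ext
      · simp only
        nlinarith [sq_nonneg (1 - (circ n u).1), sq_nonneg (circ n u).2]
      · simp only
        nlinarith [sq_nonneg (1 - (circ n u).1), sq_nonneg (circ n u).2]
  refine ⟨rfl, ?_⟩
  have hn' : (n : ℝ) ≠ 0 := by positivity
  have h5 := congrArg Prod.fst h
  have h6 := congrArg Prod.snd h
  simp only [circ] at h5 h6
  field_simp at h5 h6
  have h5' : Real.cos (2 * Real.pi * u) = Real.cos (2 * Real.pi * v) := by linarith
  have h7 : Real.cos (2 * Real.pi * u - 2 * Real.pi * v) = 1 := by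
    rw [Real.cos_sub, h5', h6]
    linarith [Real.sin_sq_add_cos_sq (2 * Real.pi * v)]
  obtain ⟨k, hk⟩ := (Real.cos_eq_one_iff _).1 h7
  refine ⟨k, ?_⟩
  have := Real.pi_pos
  field_simp at hk
  linarith

/-- The map from the base interval onto the earring, which sends `[1 / (n + 1), 1 / n]` to the
`n`-th circle. -/
def spiral (s : ℝ) : ℝ × ℝ := circ ⌊1 / s⌋₊ (1 / s)

/-- At `s = 0` the first factor tends to zero while `h` stays bounded. Where `1 / s` is an integer
the floor jumps, but `h` vanishes there and the first factor is bounded. Elsewhere the floor is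
locally constant. -/
theorem continuous_floor_mul {h : ℝ → ℝ} (hc : Continuous h) (hb : ∀ u, |h u| ≤ 2)
    (h0 : ∀ n : ℕ, h n = 0) :
    Continuous fun s : I => 1 / (2 * (⌊1 / (s : ℝ)⌋₊ : ℝ)) * h (1 / s) := by
  have hR : ∀ s : I, |1 / (2 * (⌊1 / (s : ℝ)⌋₊ : ℝ))| ≤ s := by
    intro s
    rw [abs_of_nonneg (by positivity)]
    rcases s.2.1.eq_or_lt with hs | hs
    · simp [← hs]
    · have h1 : 1 ≤ 1 / (s : ℝ) := by rw [le_div_iff₀ hs]; linarith [s.2.2]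
      have h2 : (1 : ℝ) ≤ ⌊1 / (s : ℝ)⌋₊ := by exact_mod_cast Nat.le_floor (by simpa using h1)
      have h3 := Nat.lt_floor_add_one (1 / (s : ℝ))
      rw [div_le_iff₀ (by positivity)]
      have h4 : 1 / (s : ℝ) ≤ 2 * ⌊1 / (s : ℝ)⌋₊ := by linarith
      rw [div_le_iff₀ hs] at h4
      linarith
  rw [continuous_iff_continuousAt]
  intro s₀
  rcases s₀.2.1.eq_or_lt with hs | hs
  -- At `0` the convention `1 / 0 = 0` supplies the value needed for continuity.
  · have hz : 1 / (2 * (⌊1 / (s₀ : ℝ)⌋₊ : ℝ)) * h (1 / s₀) = 0 := by simp [← hs]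
    rw [ContinuousAt, hz]
    refine squeeze_zero_norm (a := fun s : I => 2 * (s : ℝ)) (fun s => ?_) ?_
    · rw [Real.norm_eq_abs, abs_mul, mul_comm]
      exact mul_le_mul (hb _) (hR s) (abs_nonneg _) zero_le_two
    · have : Continuous fun s : I => 2 * (s : ℝ) := by fun_prop
      have h2 := this.tendsto s₀
      simp only [← hs, mul_zero] at h2
      exact h2
  · have hinv : ContinuousAt (fun s : I => 1 / (s : ℝ)) s₀ :=
      continuousAt_const.div continuous_subtype_val.continuousAt hs.ne'
    have hh : ContinuousAt (fun s : I => h (1 / (s : ℝ))) s₀ := hc.continuousAt.comp hinv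
    by_cases hk : ∃ k : ℕ, 1 / (s₀ : ℝ) = k
    · obtain ⟨k, hk⟩ := hk
      have hz : h (1 / s₀) = 0 := by rw [hk, h0]
      rw [ContinuousAt, hz, mul_zero]
      rw [ContinuousAt, hz] at hh
      refine squeeze_zero_norm (a := fun s : I => |h (1 / (s : ℝ))|) (fun s => ?_) ?_
      · rw [Real.norm_eq_abs, abs_mul]
        exact mul_le_of_le_one_left (abs_nonneg _) ((hR s).trans s.2.2)
      · simpa using hh.abs
    · refine (continuousAt_const (y := 1 / (2 * (⌊1 / (s₀ : ℝ)⌋₊ : ℝ)))).mul hh |>.congr ?_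
      have hpos : 0 ≤ 1 / (s₀ : ℝ) := by positivity
      have hmem : 1 / (s₀ : ℝ) ∈ Set.Ioo (⌊1 / (s₀ : ℝ)⌋₊ : ℝ) (⌊1 / (s₀ : ℝ)⌋₊ + 1) :=
        ⟨lt_of_le_of_ne (Nat.floor_le hpos) fun h' => hk ⟨_, h'.symm⟩, Nat.lt_floor_add_one _⟩
      filter_upwards [hinv.preimage_mem_nhds (isOpen_Ioo.mem_nhds hmem)] with s hs'
      have : ⌊1 / (s : ℝ)⌋₊ = ⌊1 / (s₀ : ℝ)⌋₊ :=
        (Nat.floor_eq_iff (one_div_nonneg.2 s.2.1)).2 ⟨hs'.1.le, hs'.2⟩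
      simp only [this, Pi.mul_apply]

theorem continuous_spiral : Continuous fun s : I => spiral s := by
  unfold spiral circ
  refine Continuous.prodMk (continuous_const.sub ?_) ?_
  · refine continuous_floor_mul (h := fun u => 1 - Real.cos (2 * Real.pi * u)) (by fun_prop) ?_ ?_
    · intro u
      rw [abs_le]
      constructor <;> linarith [Real.neg_one_le_cos (2 * Real.pi * u),
        Real.cos_le_one (2 * Real.pi * u)]
    · intro n
      rw [mul_comm, Real.cos_nat_mul_two_pi, sub_self]
  · refine continuous_floor_mul (h := fun u => Real.sin (2 * Real.pi * u)) (by fun_prop) ?_ ?_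
    · intro u
      exact (Real.abs_sin_le_one _).trans one_le_two
    · intro n
      have : 2 * Real.pi * n = (2 * n : ℕ) * Real.pi := by push_cast; ring
      rw [this, Real.sin_nat_mul_pi]

theorem spiral_zero : spiral 0 = (1, 0) := by
  simp [spiral, circ]

theorem spiral_invNat (n : ℕ) : spiral (invNat n) = (1, 0) := by
  simp only [spiral, invNat, one_div_one_div]
  exact circ_natCast _ _

/-- The parameter of the point `u` of the `n`-th circle. -/
def circParam (n : ℕ) (hn : 1 ≤ n) (u : ℝ) : I :=
  ⟨1 / (n + Int.fract u), by have := Int.fract_nonneg u; positivity, by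
    have h := Int.fract_nonneg u
    have : (1 : ℝ) ≤ n := by exact_mod_cast hn
    rw [div_le_iff₀ (by linarith)]
    linarith⟩

theorem spiral_circParam {n : ℕ} (hn : 1 ≤ n) (u : ℝ) : spiral (circParam n hn u) = circ n u := by
  have h0 := Int.fract_nonneg u
  have h1 := Int.fract_lt_one u
  have hf : ⌊(n : ℝ) + Int.fract u⌋₊ = n :=
    (Nat.floor_eq_iff (by positivity)).2 ⟨by linarith, by linarith⟩
  simp only [spiral, circParam, one_div_one_div, hf]
  rw [← circ_fract n u, add_comm]
  exact_mod_cast circ_add_int n (Int.fract u) n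

theorem spiral_eq_base {s : I} (h : spiral s = (1, 0)) : s ∈ ropeEnds := by
  rcases s.2.1.eq_or_lt with hs | hs
  · exact Or.inl (Subtype.ext hs.symm)
  · have h1 : 1 ≤ 1 / (s : ℝ) := by rw [le_div_iff₀ hs]; linarith [s.2.2]
    obtain ⟨k, hk⟩ := circ_eq_base (Nat.le_floor (by simpa using h1)) h
    have hk1 : (1 : ℝ) ≤ k := hk ▸ h1
    lift k to ℕ using by exact_mod_cast zero_le_one.trans hk1
    refine Or.inr ⟨k, by exact_mod_cast hk1, Subtype.ext ?_⟩
    simp only [invNat]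
    rw [Int.cast_natCast] at hk
    rw [← hk, one_div_one_div]

/-- Off the base point the circle is determined, so `1 / s` and `1 / t` have the same floor;
differing by an integer, they agree. -/
theorem spiral_injOn {s t : I} (h : spiral s = spiral t) (h0 : spiral s ≠ (1, 0)) : s = t := by
  have key : ∀ s : I, spiral s ≠ (1, 0) → 0 < (s : ℝ) ∧ 1 ≤ ⌊1 / (s : ℝ)⌋₊ := by
    intro s hs
    have hpos : 0 < (s : ℝ) := by
      refine s.2.1.lt_of_ne fun h => hs ?_
      rw [← h, spiral_zero]
    refine ⟨hpos, Nat.le_floor ?_⟩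
    rw [Nat.cast_one, le_div_iff₀ hpos]
    linarith [s.2.2]
  obtain ⟨hs, hs1⟩ := key s h0
  obtain ⟨ht, ht1⟩ := key t (h ▸ h0)
  obtain ⟨h1, k, hk⟩ := circ_eq_circ hs1 ht1 h h0
  have a1 := Nat.floor_le (one_div_nonneg.2 s.2.1)
  have a2 := Nat.lt_floor_add_one (1 / (s : ℝ))
  have b1 := Nat.floor_le (one_div_nonneg.2 t.2.1)
  have b2 := Nat.lt_floor_add_one (1 / (t : ℝ))
  rw [h1] at a1 a2
  have k1 : (k : ℝ) < 1 := by linarith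
  have k2 : (-1 : ℝ) < k := by linarith
  have hk0 : k = 0 := by
    have : k < 1 := by exact_mod_cast k1
    have : -1 < k := by exact_mod_cast k2
    omega
  rw [hk0, Int.cast_zero, sub_eq_zero] at hk
  exact Subtype.ext (by simpa using hk)

/-- Every rope goes to the class of `0`, so the base interval alone surjects onto the quotient,
which is therefore compact. -/
theorem Collapse.exists_pt (q : Collapse ropes) :
    ∃ s, collapseMap ropes (HR.pt 0 s) = q := by
  induction q using Quotient.ind with
  | _ x =>
    obtain ⟨n, s, rfl⟩ := HR.exists_pt x
    rcases Nat.eq_zero_or_pos n with rfl | hn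
    · exact ⟨s, rfl⟩
    · exact ⟨0, Quotient.sound (Or.inr ⟨HR.pt_zero_mem_ropes.2 (Or.inl rfl),
        HR.pt_mem_ropes hn s⟩)⟩

instance : CompactSpace (Collapse ropes) := by
  have hc : Continuous fun s => collapseMap ropes (HR.pt 0 s) :=
    (collapseMap ropes).continuous.comp (HR.continuous_pt 0)
  refine ⟨?_⟩
  rw [← Set.range_eq_univ.2 Collapse.exists_pt]
  exact isCompact_range hc

/-- A map out of `HR / A` given by its restriction to the base interval. -/
def Collapse.lift {Z : Type*} (g : I → Z) (z : Z) (h : ∀ s ∈ ropeEnds, g s = z) :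
    Collapse ropes → Z :=
  Quotient.lift (HR.lift (fun n s => if n = 0 then g s else z)
    (fun n => by simp [h 0 (Or.inl rfl)])
    (fun n hn => by
      have : n ≠ 0 := by omega
      simp [this, h (invNat n) (Or.inr ⟨n, hn, rfl⟩)]))
    (by
      have key : ∀ x ∈ ropes, HR.lift (fun n s => if n = 0 then g s else z)
          (fun n => by simp [h 0 (Or.inl rfl)])
          (fun n hn => by
            have : n ≠ 0 := by omega
            simp [this, h (invNat n) (Or.inr ⟨n, hn, rfl⟩)]) x = z := by
        intro x hx
        obtain ⟨n, s, rfl⟩ := HR.exists_pt x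
        change (if n = 0 then g s else z) = z
        split_ifs with hn
        · subst hn
          exact h s (HR.pt_zero_mem_ropes.1 hx)
        · rfl
      rintro x y (rfl | ⟨hx, hy⟩)
      · rfl
      · rw [key x hx, key y hy])

theorem Collapse.lift_pt {Z : Type*} (g : I → Z) (z : Z) (h : ∀ s ∈ ropeEnds, g s = z) (s : I) :
    Collapse.lift g z h (collapseMap ropes (HR.pt 0 s)) = g s := rfl

theorem Collapse.continuous_lift {Z : Type*} [TopologicalSpace Z] {g : I → Z} {z : Z}
    {h : ∀ s ∈ ropeEnds, g s = z} (hg : Continuous g) : Continuous (Collapse.lift g z h) := by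
  refine continuous_quot_lift _ (HR.continuous_of_pt' fun n => ?_)
  change Continuous fun s => if n = 0 then g s else z
  split_ifs
  · exact hg
  · exact continuous_const

/-- The comparison map from `HR / A` to the earring. -/
def toEarring : Collapse ropes → earring :=
  Collapse.lift (fun s => ⟨spiral s, circ_mem_earring _ _⟩) ⟨(1, 0), base_mem_earring⟩ (by
    rintro _ (rfl | ⟨n, hn, rfl⟩)
    · exact Subtype.ext spiral_zero
    · exact Subtype.ext (spiral_invNat n))

theorem toEarring_bijective : Function.Bijective toEarring := by
  constructor
  · intro q q' h
    obtain ⟨s, rfl⟩ := Collapse.exists_pt q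
    obtain ⟨t, rfl⟩ := Collapse.exists_pt q'
    replace h : spiral s = spiral t := congrArg Subtype.val h
    by_cases h0 : spiral s = (1, 0)
    · exact Quotient.sound (Or.inr ⟨HR.pt_zero_mem_ropes.2 (spiral_eq_base h0),
        HR.pt_zero_mem_ropes.2 (spiral_eq_base (h ▸ h0))⟩)
    · rw [spiral_injOn h h0]
  · rintro ⟨p, hp⟩
    obtain ⟨n, u, hn, rfl⟩ := exists_circ_eq hp
    exact ⟨collapseMap ropes (HR.pt 0 (circParam n hn u)), Subtype.ext (spiral_circParam hn u)⟩

/-- The homeomorphism between `HR / A` and the earring. -/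
def earringHomeo : Collapse ropes ≃ₜ earring :=
  (Collapse.continuous_lift (continuous_spiral.subtype_mk _) :
    Continuous toEarring).homeoOfEquivCompactToT2 (f := Equiv.ofBijective _ toEarring_bijective)

/-! ### The retractions of the earring onto its circles -/

/-- The function on the base interval which is constant outside `[1 / (m + 1), 1 / m]` and equal
to the inverse there. -/
def clampInv (m : ℕ) (s : ℝ) : ℝ := max m (1 / max s (1 / (m + 1)))

theorem continuous_clampInv (m : ℕ) : Continuous (clampInv m) := by
  have hpos : (0 : ℝ) < 1 / (m + 1) := by positivity
  refine continuous_const.max (continuous_const.div (by fun_prop) fun s => ?_)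
  exact (hpos.trans_le (le_max_right _ _)).ne'

theorem clampInv_zero (m : ℕ) : clampInv m 0 = (m + 1 : ℕ) := by
  have hpos : (0 : ℝ) < 1 / (m + 1) := by positivity
  rw [clampInv, max_eq_right hpos.le, one_div_one_div]
  push_cast
  exact max_eq_right (by linarith)

theorem clampInv_inv (m : ℕ) {u : ℝ} (hu : 0 < u) : clampInv m (1 / u) = max (m : ℝ) (min u (m + 1)) := by
  rw [clampInv]
  congr 1
  rcases le_total u (m + 1) with h | h
  · rw [min_eq_left h, max_eq_left (one_div_le_one_div_of_le hu h), one_div_one_div]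
  · rw [min_eq_right h, max_eq_right (one_div_le_one_div_of_le (by positivity) h), one_div_one_div]

theorem coe_natCast_addCircle (k : ℕ) : (((k : ℝ)) : AddCircle (1 : ℝ)) = 0 := by
  rw [AddCircle.coe_eq_zero_iff]
  exact ⟨k, by simp⟩

theorem coe_clampInv_eq_zero (m : ℕ) (s : I) (hs : s ∈ ropeEnds) :
    ((clampInv m s : ℝ) : AddCircle (1 : ℝ)) = 0 := by
  rcases hs with rfl | ⟨n, hn, rfl⟩
  · rw [Set.Icc.coe_zero, clampInv_zero, coe_natCast_addCircle]
  · have h : clampInv m (invNat n) = (max m (min n (m + 1)) : ℕ) := by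
      rw [invNat, clampInv_inv m (by exact_mod_cast hn)]
      push_cast
      rfl
    rw [h, coe_natCast_addCircle]

/-- The map from the earring to the circle which is the projection of the `m`-th circle and
collapses all the other circles. -/
def windingMap (m : ℕ) : C(earring, AddCircle (1 : ℝ)) where
  toFun p := Collapse.lift (fun s => ((clampInv m s : ℝ) : AddCircle (1 : ℝ))) 0
    (coe_clampInv_eq_zero m) (earringHomeo.symm p)
  continuous_toFun := by
    refine (Collapse.continuous_lift ?_).comp earringHomeo.symm.continuous
    exact (AddCircle.continuous_mk' 1).comp ((continuous_clampInv m).comp continuous_subtype_val)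

/-- The clamp sends circles below the `m`-th to `m` and circles above it to `m + 1`, both zero
modulo `1`; on the `m`-th circle it does nothing. -/
theorem windingMap_circ (m : ℕ) {n : ℕ} (hn : 1 ≤ n) (u : ℝ) :
    windingMap m ⟨circ n u, circ_mem_earring n u⟩ =
      if n = m then (u : AddCircle (1 : ℝ)) else 0 := by
  have h : earringHomeo.symm ⟨circ n u, circ_mem_earring n u⟩ =
      collapseMap ropes (HR.pt 0 (circParam n hn u)) := by
    rw [Homeomorph.symm_apply_eq]
    exact Subtype.ext (spiral_circParam hn u).symm
  change Collapse.lift _ _ (coe_clampInv_eq_zero m) (earringHomeo.symm _) = _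
  rw [h, Collapse.lift_pt]
  have h0 := Int.fract_nonneg u
  have h1 := Int.fract_lt_one u
  have hn' : (1 : ℝ) ≤ n := by exact_mod_cast hn
  rw [circParam, clampInv_inv m (by linarith)]
  rcases lt_trichotomy n m with h2 | h2 | h2
  · have h3 : (n : ℝ) + 1 ≤ m := by exact_mod_cast h2
    rw [if_neg h2.ne, max_eq_left ((min_le_left _ _).trans (by linarith)), coe_natCast_addCircle]
  · subst h2
    rw [if_pos rfl, min_eq_left (by linarith), max_eq_right (by linarith), AddCircle.coe_add,
      coe_natCast_addCircle, zero_add]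
    conv_rhs => rw [← Int.floor_add_fract u, AddCircle.coe_add]
    rw [right_eq_add, AddCircle.coe_eq_zero_iff]
    exact ⟨⌊u⌋, by simp⟩
  · have h3 : (m : ℝ) + 1 ≤ n := by exact_mod_cast h2
    rw [if_neg h2.ne', min_eq_right (by linarith), max_eq_right (by linarith)]
    exact_mod_cast coe_natCast_addCircle (m + 1)

/-! ### A criterion for groups to be uncountable and not free -/

/-- The `ℓ¹` norm on a free abelian group. -/
def l1norm {X : Type*} (v : X →₀ ℤ) : ℕ := v.sum fun _ a => a.natAbs

theorem l1norm_add_le {X : Type*} (v w : X →₀ ℤ) : l1norm (v + w) ≤ l1norm v + l1norm w := by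
  classical
  have h : ∀ u : X →₀ ℤ, u.support ⊆ v.support ∪ w.support → l1norm u =
      ∑ x ∈ v.support ∪ w.support, (u x).natAbs := fun u hu =>
    Finsupp.sum_of_support_subset _ hu _ (by simp)
  rw [h v Finset.subset_union_left, h w Finset.subset_union_right, h _ Finsupp.support_add,
    ← Finset.sum_add_distrib]
  exact Finset.sum_le_sum fun x _ => Int.natAbs_add_le _ _

theorem l1norm_neg {X : Type*} (v : X →₀ ℤ) : l1norm (-v) = l1norm v := by
  rw [l1norm, Finsupp.sum_neg_index (by simp)]
  simp [l1norm]

theorem l1norm_nsmul {X : Type*} (k : ℕ) (v : X →₀ ℤ) : l1norm (k • v) = k * l1norm v := by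
  rw [l1norm, Finsupp.sum_of_support_subset _ Finsupp.support_smul _ (by simp), l1norm,
    Finsupp.sum, Finset.mul_sum]
  simp [Int.natAbs_mul]

theorem l1norm_pos {X : Type*} {v : X →₀ ℤ} (hv : v ≠ 0) : 0 < l1norm v := by
  obtain ⟨x, hx⟩ := Finsupp.support_nonempty_iff.2 hv
  exact Finset.sum_pos (fun y hy => Int.natAbs_pos.2 (Finsupp.mem_support_iff.1 hy)) ⟨x, hx⟩

/-- With `A = l1norm (a n)`, the recursion gives `(A + 2) * l1norm (v (n + 1)) ≤ l1norm (v n) + A`.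
If no term vanishes, the norms are at least `1`, hence strictly decreasing: an infinite descent. -/
theorem exists_eq_zero_of_recursion {X : Type*} (v a : ℕ → X →₀ ℤ)
    (h : ∀ n, v n = (l1norm (a n) + 2) • v (n + 1) + a n) : ∃ n, v n = 0 := by
  by_contra! hv
  have hlt : ∀ n, l1norm (v (n + 1)) < l1norm (v n) := by
    intro n
    have h1 : (l1norm (a n) + 2) • v (n + 1) = v n + -a n := by rw [h n]; abel
    have h2 := l1norm_add_le (v n) (-a n)
    rw [← h1, l1norm_nsmul, l1norm_neg] at h2
    have h3 := l1norm_pos (hv (n + 1))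
    nlinarith
  obtain ⟨n, hn⟩ := WellFounded.not_rel_apply_succ (r := (· < ·)) fun n => l1norm (v n)
  exact hn (hlt n)

/-- The abelianization of a free group. -/
def freeAbel (X : Type*) : FreeGroup X →* Multiplicative (X →₀ ℤ) :=
  FreeGroup.lift fun x => Multiplicative.ofAdd (Finsupp.single x 1)

/-- A homomorphism to an abelian group factors through the abelianization. -/
theorem eq_one_of_freeAbel_eq_one {X : Type*} (u : FreeGroup X →* Multiplicative ℝ)
    {g : FreeGroup X} (hg : freeAbel X g = 1) : u g = 1 := by
  let L : (X →₀ ℤ) →+ ℝ :=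
    Finsupp.liftAddHom fun x => zmultiplesHom ℝ (u (FreeGroup.of x)).toAdd
  have h : u = (AddMonoidHom.toMultiplicative L).comp (freeAbel X) := by
    ext x
    simp [L, freeAbel]
  rw [h, MonoidHom.comp_apply, hg, map_one]

section Criterion

variable {G : Type*} [Group G] (w : ℕ → G →* Multiplicative ℝ) (c : ℕ → G)
  (hw : ∀ m n, w m (c n) = if n = m then Multiplicative.ofAdd 1 else 1)
  (hx : ∀ k : ℕ → ℕ, ∃ x : ℕ → G, (∀ n, x n = x (n + 1) ^ k n * c n) ∧
    ∀ m n, m < n → w m (x n) = 1)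

include hw

/-- For `n < m` the factor `c n` is invisible to `w m`, so each unrolling contributes only `k n`. At
`n = m` the factor `c m` counts one and `x (m + 1)` counts nothing. -/
theorem toAdd_eq_prod {k : ℕ → ℕ} {x : ℕ → G} (h1 : ∀ n, x n = x (n + 1) ^ k n * c n)
    (h2 : ∀ m n, m < n → w m (x n) = 1) (m : ℕ) :
    (w m (x 0)).toAdd = ∏ i ∈ Finset.range m, (k i : ℝ) := by
  have key : ∀ n ≤ m, (w m (x 0)).toAdd =
      (∏ i ∈ Finset.range n, (k i : ℝ)) * (w m (x n)).toAdd := by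
    intro n hn
    induction n with
    | zero => simp
    | succ n ih =>
      rw [ih (by omega), h1 n, map_mul, map_pow, hw, if_neg (by omega), mul_one, toAdd_pow,
        Finset.prod_range_succ, nsmul_eq_mul, mul_assoc]
  rw [key m le_rfl, h1 m, map_mul, map_pow, hw, if_pos rfl, h2 m (m + 1) m.lt_succ_self]
  simp

include hx

theorem uncountable_of_recursion : Uncountable G := by
  choose x h1 h2 using hx
  -- Nonzero exponents allow cancelling the partial products and recovering `b` term by term.
  let k : (ℕ → Bool) → ℕ → ℕ := fun b n => if b n then 2 else 1
  have hinj : Function.Injective fun b => x (k b) 0 := by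
    intro b b' hb
    replace hb : x (k b) 0 = x (k b') 0 := hb
    have hprod : ∀ m, ∏ i ∈ Finset.range m, (k b i : ℝ) = ∏ i ∈ Finset.range m, (k b' i : ℝ) := by
      intro m
      rw [← toAdd_eq_prod w c hw (h1 _) (h2 _) m, ← toAdd_eq_prod w c hw (h1 _) (h2 _) m, hb]
    funext n
    have h3 := hprod (n + 1)
    have h4 : ∏ i ∈ Finset.range n, (k b' i : ℝ) ≠ 0 := by
      refine Finset.prod_ne_zero_iff.2 fun i _ => ?_
      simp only [k]
      split_ifs <;> norm_num
    rw [Finset.prod_range_succ, Finset.prod_range_succ, hprod n] at h3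
    have h5 := mul_left_cancel₀ h4 h3
    simp only [k] at h5
    cases hbn : b n <;> cases hbn' : b' n <;> simp [hbn, hbn'] at h5 ⊢
  have : Uncountable (ℕ → Bool) := by
    rw [← Cardinal.aleph0_lt_mk_iff]
    simpa using Cardinal.aleph0_lt_continuum
  exact hinj.uncountable

theorem not_isFreeGroup_of_recursion : ¬ IsFreeGroup G := by
  intro hG
  let e : G ≃* FreeGroup (IsFreeGroup.Generators G) := IsFreeGroup.toFreeGroup G
  let a : G → (IsFreeGroup.Generators G →₀ ℤ) := fun g => (freeAbel _ (e g)).toAdd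
  -- The exponents depend on the supposed free basis, which is why the hypothesis has to cover every
  -- sequence `k`.
  obtain ⟨x, h1, h2⟩ := hx fun n => l1norm (a (c n)) + 2
  obtain ⟨n, hn⟩ := exists_eq_zero_of_recursion (fun n => a (x n)) (fun n => a (c n)) (by
    intro n
    simp only [a]
    conv_lhs => rw [h1 n]
    rw [map_mul, map_pow, map_mul, map_pow, toAdd_mul, toAdd_pow])
  have h3 := eq_one_of_freeAbel_eq_one ((w n).comp e.symm.toMonoidHom) (g := e (x n))
    (Multiplicative.toAdd.injective hn)
  simp only [MonoidHom.comp_apply, MulEquiv.coe_toMonoidHom, e.symm_apply_apply] at h3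
  rw [h1 n, map_mul, map_pow, h2 n (n + 1) n.lt_succ_self, hw, if_pos rfl, one_pow, one_mul] at h3
  exact one_ne_zero (α := ℝ) (Multiplicative.ofAdd.injective h3)

end Criterion

/-! ### Winding numbers -/

/-- The winding number of loops in the circle. -/
def circleDegree : FundamentalGroup (AddCircle (1 : ℝ)) 0 →* Multiplicative ℝ where
  toFun γ := Multiplicative.ofAdd ((((AddCircle.isAddQuotientCoveringMap_coe
    (1 : ℝ)).fundamentalGroupToMulOpposite (x := 0) ⟨0, rfl⟩ γ).unop.toAdd :
      AddSubgroup.zmultiples (1 : ℝ)) : ℝ)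
  map_one' := by rw [map_one]; rfl
  map_mul' γ γ' := by
    rw [map_mul, MulOpposite.unop_mul, toAdd_mul, AddSubgroup.coe_add, ofAdd_add, mul_comm]

/-- The monodromy moves `0` to the end of the lift, and the degree is the deck translation doing the
same. -/
theorem circleDegree_of_lift (γ : Path (0 : AddCircle (1 : ℝ)) 0) (Γ : C(I, ℝ)) (h0 : Γ 0 = 0)
    (h : ∀ t, (Γ t : AddCircle (1 : ℝ)) = γ t) :
    circleDegree (FundamentalGroup.fromPath (Path.Homotopic.Quotient.mk γ)) =
      Multiplicative.ofAdd (Γ 1) := by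
  have hp := AddCircle.isAddQuotientCoveringMap_coe (1 : ℝ)
  let e : ((↑) : ℝ → AddCircle (1 : ℝ)) ⁻¹' {0} := ⟨0, rfl⟩
  let e' : ((↑) : ℝ → AddCircle (1 : ℝ)) ⁻¹' {0} := ⟨Γ 1, by simp [h]⟩
  have h1 : hp.isCoveringMap.monodromy (Path.Homotopic.Quotient.mk γ) e = e' := by
    refine hp.isCoveringMap.monodromy_eq_of_map_eq
      (Path.Homotopic.Quotient.mk (⟨Γ, h0, rfl⟩ : Path (0 : ℝ) (Γ 1))) ?_
    refine congrArg Path.Homotopic.Quotient.mk ?_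
    ext t
    exact h t
  have h2 := hp.unop_fundamentalGroupToMulOpposite_smul (e := e)
    (γ := FundamentalGroup.fromPath (Path.Homotopic.Quotient.mk γ))
  refine congrArg Multiplicative.ofAdd ?_
  have h3 := h2.trans (congrArg Subtype.val h1)
  change _ + (0 : ℝ) = Γ 1 at h3
  rwa [add_zero] at h3

/-- The winding number of loops with respect to a map to the circle. -/
def windingHom {X : Type*} [TopologicalSpace X] (f : C(X, AddCircle (1 : ℝ))) {x : X}
    (h : f x = 0) : FundamentalGroup X x →* Multiplicative ℝ :=
  circleDegree.comp (FundamentalGroup.mapOfEq f h)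

theorem windingHom_of_lift {X : Type*} [TopologicalSpace X] (f : C(X, AddCircle (1 : ℝ))) {x : X}
    (hx : f x = 0) (γ : Path x x) (Γ : C(I, ℝ)) (h0 : Γ 0 = 0)
    (h : ∀ t, (Γ t : AddCircle (1 : ℝ)) = f (γ t)) :
    windingHom f hx (FundamentalGroup.fromPath (Path.Homotopic.Quotient.mk γ)) =
      Multiplicative.ofAdd (Γ 1) := by
  rw [windingHom, MonoidHom.comp_apply, FundamentalGroup.mapOfEq_apply]
  exact circleDegree_of_lift ((γ.map f.continuous).cast hx.symm hx.symm) Γ h0 h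

/-! ### Loops given by periodic maps -/

/-- The loop given by a map on the real line which takes the value `x` at the integers. -/
def periodicPath {X : Type*} [TopologicalSpace X] {x : X} (F : C(ℝ, X)) (h : ∀ k : ℕ, F k = x) :
    Path x x where
  toFun t := F t
  continuous_toFun := by fun_prop
  source' := by simpa using h 0
  target' := by simpa using h 1

/-- The class of the loop `periodicPath F h`. -/
def periodicLoop {X : Type*} [TopologicalSpace X] {x : X} (F : C(ℝ, X)) (h : ∀ k : ℕ, F k = x) :
    FundamentalGroup X x :=
  FundamentalGroup.fromPath (Path.Homotopic.Quotient.mk (periodicPath F h))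

/-- The line is simply connected, so running from `0` to `k` and then to `k + 1` is homotopic to
running linearly to `k + 1`; apply `F`, whose periodicity absorbs the shift by `k`. -/
theorem periodicLoop_pow {X : Type*} [TopologicalSpace X] {x : X} (F : C(ℝ, X))
    (h : ∀ k : ℕ, F k = x) (hF : ∀ t, F (t + 1) = F t) (k : ℕ) :
    periodicLoop F h ^ k = periodicLoop (F.comp ⟨fun t => k * t, by fun_prop⟩)
      (fun n => by simpa using h (k * n)) := by
  have hF' : ∀ (n : ℕ) t, F (n + t) = F t := by
    intro n
    induction n with
    | zero => simp
    | succ n ih =>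
      intro t
      rw [← ih t, ← hF (n + t)]
      push_cast
      ring_nf
  induction k with
  | zero =>
    refine congrArg Path.Homotopic.Quotient.mk ?_
    ext t
    simpa [periodicPath] using (h 0).symm
  | succ k ih =>
    rw [pow_succ', ih]
    let p : Path (0 : ℝ) k := ⟨⟨fun t => k * t, by fun_prop⟩, by simp, by simp⟩
    let q : Path (k : ℝ) (k + 1 : ℕ) := ⟨⟨fun t => k + t, by fun_prop⟩, by simp, by simp⟩
    let r : Path (0 : ℝ) (k + 1 : ℕ) := ⟨⟨fun t => (k + 1 : ℕ) * t, by fun_prop⟩, by simp, by simp⟩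
    have hpq := ((SimplyConnectedSpace.paths_homotopic (p.trans q) r).map F).pathCast
      (by simpa using (h 0).symm) (h (k + 1)).symm
    refine (Path.Homotopic.Quotient.eq (p := Path.trans _ _)).2 ?_
    convert hpq using 1
    · ext t
      simp only [Path.trans_apply, Path.cast_coe, Path.map_coe, Function.comp_apply]
      split_ifs
      · rfl
      · exact (hF' k _).symm
    · rfl

/-! ### Self-similar loops -/

/-- The map of degree one which is constant on the second half of each period. -/
def firstHalf (t : ℝ) : ℝ := t + (min 1 (2 * Int.fract t) - Int.fract t)

/-- The map of degree one which is constant on the first half of each period. -/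
def secondHalf (t : ℝ) : ℝ := 2 * t - firstHalf t

theorem continuous_firstHalf : Continuous firstHalf := by
  have : Continuous ((fun s : ℝ => min 1 (2 * s) - s) ∘ Int.fract) :=
    ContinuousOn.comp_fract'' (by fun_prop) (by norm_num)
  exact continuous_id.add this

theorem continuous_secondHalf : Continuous secondHalf :=
  (continuous_const.mul continuous_id).sub continuous_firstHalf

theorem firstHalf_add_int (t : ℝ) (k : ℤ) : firstHalf (t + k) = firstHalf t + k := by
  rw [firstHalf, firstHalf, Int.fract_add_intCast]
  ring

theorem secondHalf_add_int (t : ℝ) (k : ℤ) : secondHalf (t + k) = secondHalf t + k := by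
  rw [secondHalf, secondHalf, firstHalf_add_int]
  ring

theorem firstHalf_zero : firstHalf 0 = 0 := by simp [firstHalf]

theorem firstHalf_int (k : ℤ) : firstHalf k = k := by
  simpa [firstHalf_zero] using firstHalf_add_int 0 k

theorem secondHalf_int (k : ℤ) : secondHalf k = k := by
  rw [secondHalf, firstHalf_int]
  ring

theorem firstHalf_of_le {t : ℝ} (h0 : 0 ≤ t) (h : t ≤ 1 / 2) : firstHalf t = 2 * t := by
  rw [firstHalf, Int.fract_eq_self.2 ⟨h0, by linarith⟩, min_eq_right (by linarith)]
  ring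

theorem firstHalf_of_ge {t : ℝ} (h0 : 1 / 2 ≤ t) (h : t ≤ 1) : firstHalf t = 1 := by
  rcases h.eq_or_lt with rfl | h
  · simpa using firstHalf_int 1
  · rw [firstHalf, Int.fract_eq_self.2 ⟨by linarith, h⟩, min_eq_left (by linarith)]
    ring

theorem firstHalf_or_secondHalf (t : ℝ) :
    (∃ k : ℤ, firstHalf t = k) ∨ ∃ k : ℤ, secondHalf t = k := by
  have h0 := Int.fract_nonneg t
  have h1 := Int.fract_lt_one t
  rcases le_total (Int.fract t) (1 / 2) with h | h
  · refine Or.inr ⟨⌊t⌋, ?_⟩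
    rw [← Int.fract_add_floor t, secondHalf_add_int, secondHalf, firstHalf_of_le h0 h]
    simp
  · refine Or.inl ⟨1 + ⌊t⌋, ?_⟩
    rw [← Int.fract_add_floor t, firstHalf_add_int, firstHalf_of_ge h h1.le]
    simp

/-- The parameter of the `j`-th loop inside a self-similar loop. -/
def nest (k : ℕ → ℕ) : ℕ → ℝ → ℝ
  | 0, t => t
  | j + 1, t => k j * secondHalf (nest k j t)

theorem continuous_nest (k : ℕ → ℕ) (j : ℕ) : Continuous (nest k j) := by
  induction j with
  | zero => exact continuous_id
  | succ j ih => exact continuous_const.mul (continuous_secondHalf.comp ih)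

/-- Peeling off the outermost step instead of the innermost one is the source of the
self-similarity. -/
theorem nest_succ' (k : ℕ → ℕ) (j : ℕ) (t : ℝ) :
    nest k (j + 1) t = nest (fun n => k (n + 1)) j (k 0 * secondHalf t) := by
  induction j with
  | zero => rfl
  | succ j ih => rw [nest, ih]; rfl

theorem nest_int_of_le {k : ℕ → ℕ} {i j : ℕ} (hij : i ≤ j) {t : ℝ}
    (h : ∃ n : ℤ, nest k i t = n) : ∃ n : ℤ, nest k j t = n := by
  induction j, hij using Nat.le_induction with
  | base => exact h
  | succ j _ ih =>
    obtain ⟨n, hn⟩ := ih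
    exact ⟨k j * n, by rw [nest, hn, secondHalf_int]; push_cast; rfl⟩

theorem nest_add_int (k : ℕ → ℕ) (j : ℕ) (t : ℝ) (n : ℤ) :
    ∃ m : ℤ, nest k j (t + n) = nest k j t + m := by
  induction j with
  | zero => exact ⟨n, rfl⟩
  | succ j ih =>
    obtain ⟨m, hm⟩ := ih
    exact ⟨k j * m, by rw [nest, hm, secondHalf_add_int, nest]; push_cast; ring⟩

/-- The self-similar loop `x` with `x = c 0 * (c 1 * (c 2 * ⋯) ^ k 1) ^ k 0`, where at each time
only one of the summands is nonzero. -/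
def selfSimilar {V : Type*} [NormedAddCommGroup V] (c : ℕ → ℝ → V) (k : ℕ → ℕ) (t : ℝ) : V :=
  ∑' j, c j (firstHalf (nest k j t))

section SelfSimilar

variable {V : Type*} [NormedAddCommGroup V] {c : ℕ → ℝ → V} {k : ℕ → ℕ}
  (hper : ∀ j u (n : ℤ), c j (u + n) = c j u) (h0 : ∀ j, c j 0 = 0)

include hper h0

theorem loop_int (j : ℕ) (n : ℤ) : c j n = 0 := by
  rw [← h0 j, ← hper j 0 n, zero_add]

omit h0 in
theorem selfSimilar_add_int (t : ℝ) (n : ℤ) : selfSimilar c k (t + n) = selfSimilar c k t := by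
  refine tsum_congr fun j => ?_
  obtain ⟨m, hm⟩ := nest_add_int k j t n
  rw [hm, firstHalf_add_int, hper]

/-- Take the first `j` whose argument is not an integer. Then `secondHalf` is an integer there,
hence so are all later arguments, and only one summand survives. This keeps the sum inside the union
of the loops. -/
theorem exists_selfSimilar_eq (t : ℝ) : ∃ j u, selfSimilar c k t = c j u := by
  have hc := loop_int hper h0
  by_cases h : ∀ j, ∃ n : ℤ, firstHalf (nest k j t) = n
  · refine ⟨0, 0, ?_⟩
    rw [h0, selfSimilar]
    refine (tsum_congr fun j => ?_).trans tsum_zero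
    obtain ⟨n, hn⟩ := h j
    rw [hn, hc]
  · rw [not_forall] at h
    classical
    let j := Nat.find h
    refine ⟨j, _, tsum_eq_single j fun i hi => ?_⟩
    rcases hi.lt_or_gt with hi | hi
    · obtain ⟨n, hn⟩ := not_not.1 (Nat.find_min h hi)
      rw [hn, hc]
    · obtain ⟨n, hn⟩ := (firstHalf_or_secondHalf (nest k j t)).resolve_left (Nat.find_spec h)
      obtain ⟨m, hm⟩ := nest_int_of_le (k := k) (t := t) (Nat.succ_le_of_lt hi)
        ⟨k j * n, by rw [nest, hn]; push_cast; rfl⟩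
      rw [hm, firstHalf_int, hc]

theorem selfSimilar_int (n : ℤ) : selfSimilar c k n = 0 := by
  refine (tsum_congr fun j => ?_).trans tsum_zero
  obtain ⟨m, hm⟩ := nest_int_of_le (k := k) (t := (n : ℝ)) (Nat.zero_le j) ⟨n, rfl⟩
  rw [hm, firstHalf_int, loop_int hper h0]

omit hper h0

variable [CompleteSpace V] {b : ℕ → ℝ} (hb : Summable b) (hcb : ∀ j u, ‖c j u‖ ≤ b j)

include hb hcb

theorem continuous_selfSimilar (hc : ∀ j, Continuous (c j)) : Continuous (selfSimilar c k) :=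
  continuous_tsum (fun j => (hc j).comp (continuous_firstHalf.comp (continuous_nest k j))) hb
    fun j _ => hcb j _

theorem selfSimilar_eq (t : ℝ) : selfSimilar c k t = c 0 (firstHalf t) +
    selfSimilar (fun j => c (j + 1)) (fun j => k (j + 1)) (k 0 * secondHalf t) := by
  rw [selfSimilar, (Summable.of_norm_bounded hb fun j => hcb j _).tsum_eq_zero_add]
  simp only [nest_succ']
  rfl

end SelfSimilar

/-! ### The fundamental group of the earring -/

/-- The base point of the earring. -/
def earringBase : earring := ⟨(1, 0), base_mem_earring⟩

/-- The parametrization of the circle number `2 ^ n` of the earring. -/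
def earringCircle (n : ℕ) : C(ℝ, earring) :=
  ⟨fun u => ⟨circ (2 ^ n) u, circ_mem_earring _ u⟩, (continuous_circ _).subtype_mk _⟩

theorem earringCircle_natCast (n k : ℕ) : earringCircle n k = earringBase :=
  Subtype.ext (circ_natCast _ k)

theorem windingMap_base (m : ℕ) : windingMap m earringBase = 0 := by
  have := windingMap_circ m le_rfl 0
  rw [AddCircle.coe_zero, ite_self] at this
  rw [← this]
  congr 1
  exact Subtype.ext (circ_zero 1).symm

theorem windingMap_earringCircle (m n : ℕ) (u : ℝ) : windingMap (2 ^ m) (earringCircle n u) =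
    if n = m then (u : AddCircle (1 : ℝ)) else 0 := by
  rw [← if_congr ((Nat.pow_right_injective le_rfl).eq_iff (a := n) (b := m)) rfl rfl]
  exact windingMap_circ (2 ^ m) Nat.one_le_two_pow u

/-- The winding number around the circle number `2 ^ m`. -/
def earringWinding (m : ℕ) : FundamentalGroup earring earringBase →* Multiplicative ℝ :=
  windingHom (windingMap (2 ^ m)) (windingMap_base _)

theorem earringWinding_circle (m n : ℕ) :
    earringWinding m (periodicLoop (earringCircle n) (earringCircle_natCast n)) =
      if n = m then Multiplicative.ofAdd 1 else 1 := by
  by_cases h : n = m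
  · rw [if_pos h]
    refine windingHom_of_lift _ _ _ ⟨fun t => (t : ℝ), by fun_prop⟩ rfl fun t => ?_
    exact ((windingMap_earringCircle m n t).trans (if_pos h)).symm
  · rw [if_neg h]
    refine windingHom_of_lift _ _ _ ⟨fun _ => 0, by fun_prop⟩ rfl fun t => ?_
    exact ((windingMap_earringCircle m n t).trans (if_neg h)).symm

/-- The circle number `2 ^ n`, translated to the origin. -/
def centredCirc (n : ℕ) (u : ℝ) : ℝ × ℝ := circ (2 ^ n) u - (1, 0)

theorem centredCirc_add_int (n : ℕ) (u : ℝ) (k : ℤ) :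
    centredCirc n (u + k) = centredCirc n u := by
  rw [centredCirc, circ_add_int, centredCirc]

theorem centredCirc_zero (n : ℕ) : centredCirc n 0 = 0 := by
  rw [centredCirc, circ_zero, sub_self]

/-- Passing to the circles with numbers `2 ^ n` makes the bounds summable, as those of order `1 / n`
for all circles would not be. -/
theorem norm_centredCirc_le (n : ℕ) (u : ℝ) : ‖centredCirc n u‖ ≤ (1 / 2) ^ n := by
  have h1 : (0 : ℝ) < 2 ^ n := by positivity
  have hpow : ((1 : ℝ) / 2) ^ n = 1 / (2 * 2 ^ n) * 2 := by
    rw [one_div_pow]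
    field_simp
  have hpos : (0 : ℝ) ≤ 1 / (2 * 2 ^ n) := by positivity
  rw [Prod.norm_def, max_le_iff, hpow]
  simp only [centredCirc, circ, Prod.fst_sub, Prod.snd_sub, Real.norm_eq_abs]
  push_cast
  constructor
  · rw [sub_sub_cancel_left, abs_neg, abs_mul, abs_of_nonneg hpos]
    refine mul_le_mul_of_nonneg_left ?_ hpos
    rw [abs_le]
    constructor <;> linarith [Real.neg_one_le_cos (2 * Real.pi * u),
      Real.cos_le_one (2 * Real.pi * u)]
  · rw [sub_zero, abs_mul, abs_of_nonneg hpos]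
    exact mul_le_mul_of_nonneg_left ((Real.abs_sin_le_one _).trans one_le_two) hpos

theorem norm_centredCirc_add_le (n j : ℕ) (u : ℝ) : ‖centredCirc (n + j) u‖ ≤ (1 / 2) ^ j :=
  (norm_centredCirc_le _ u).trans
    (pow_le_pow_of_le_one (by norm_num) (by norm_num) (Nat.le_add_left j n))

/-- The self-similar loop built from the circles with numbers `2 ^ n`, `2 ^ (n + 1)`, …, translated
to the origin. -/
def nestedCirc (k : ℕ → ℕ) (n : ℕ) : ℝ → ℝ × ℝ :=
  selfSimilar (fun j => centredCirc (n + j)) (fun j => k (n + j))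

theorem exists_nestedCirc_eq (k : ℕ → ℕ) (n : ℕ) (t : ℝ) :
    ∃ j u, n ≤ j ∧ nestedCirc k n t + (1, 0) = circ (2 ^ j) u := by
  obtain ⟨j, u, h⟩ := exists_selfSimilar_eq (c := fun j => centredCirc (n + j))
    (k := fun j => k (n + j)) (fun j => centredCirc_add_int _) (fun j => centredCirc_zero _) t
  exact ⟨n + j, u, n.le_add_right j, by rw [nestedCirc, h, centredCirc, sub_add_cancel]⟩

/-- The self-similar loop built from the circles with numbers `2 ^ n`, `2 ^ (n + 1)`, … -/
def earringNested (k : ℕ → ℕ) (n : ℕ) : C(ℝ, earring) where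
  toFun t := ⟨nestedCirc k n t + (1, 0), by
    obtain ⟨j, u, -, h⟩ := exists_nestedCirc_eq k n t
    rw [h]
    exact circ_mem_earring _ _⟩
  continuous_toFun := by
    refine Continuous.subtype_mk (Continuous.add ?_ continuous_const) _
    exact continuous_selfSimilar summable_geometric_two (norm_centredCirc_add_le n)
      fun j => (continuous_circ _).sub continuous_const

theorem earringNested_int (k : ℕ → ℕ) (n : ℕ) (i : ℤ) : earringNested k n i = earringBase := by
  refine Subtype.ext ?_
  change selfSimilar _ _ _ + _ = _
  rw [selfSimilar_int (fun j => centredCirc_add_int _) (fun j => centredCirc_zero _), zero_add]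
  rfl

theorem earringNested_natCast (k : ℕ → ℕ) (n i : ℕ) : earringNested k n i = earringBase := by
  exact_mod_cast earringNested_int k n i

theorem earringNested_add_one (k : ℕ → ℕ) (n : ℕ) (t : ℝ) :
    earringNested k n (t + 1) = earringNested k n t := by
  refine Subtype.ext (congrArg (· + ((1, 0) : ℝ × ℝ)) ?_)
  have := selfSimilar_add_int (c := fun j => centredCirc (n + j))
    (k := fun j => k (n + j)) (fun j => centredCirc_add_int _) t 1
  rwa [Int.cast_one] at this

theorem nestedCirc_eq (k : ℕ → ℕ) (n : ℕ) (t : ℝ) : nestedCirc k n t =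
    centredCirc n (firstHalf t) + nestedCirc k (n + 1) (k n * secondHalf t) := by
  rw [nestedCirc, selfSimilar_eq summable_geometric_two (norm_centredCirc_add_le n), nestedCirc]
  simp only [add_zero, add_assoc, add_comm 1]

theorem earringNested_of_le (k : ℕ → ℕ) (n : ℕ) {t : ℝ} (h0 : 0 ≤ t) (h : t ≤ 1 / 2) :
    earringNested k n t = earringCircle n (2 * t) := by
  refine Subtype.ext ?_
  have h1 : nestedCirc k (n + 1) 0 = 0 := by
    have := selfSimilar_int (c := fun j => centredCirc (n + 1 + j))
      (k := fun j => k (n + 1 + j)) (fun j => centredCirc_add_int _)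
      (fun j => centredCirc_zero _) 0
    rwa [Int.cast_zero] at this
  change nestedCirc k n t + (1, 0) = circ (2 ^ n) (2 * t)
  rw [nestedCirc_eq, secondHalf, firstHalf_of_le h0 h, sub_self, mul_zero, h1, add_zero,
    centredCirc, sub_add_cancel]

theorem earringNested_of_ge (k : ℕ → ℕ) (n : ℕ) {t : ℝ} (h0 : 1 / 2 ≤ t) (h : t ≤ 1) :
    earringNested k n t = earringNested k (n + 1) (k n * (2 * t - 1)) := by
  refine Subtype.ext ?_
  have h1 : centredCirc n 1 = 0 := by
    rw [← centredCirc_zero n, ← centredCirc_add_int n 0 1]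
    simp
  change nestedCirc k n t + (1, 0) = nestedCirc k (n + 1) _ + (1, 0)
  rw [nestedCirc_eq, secondHalf, firstHalf_of_ge h0 h, h1, zero_add]

/-- The class of the loop `earringNested k n`. -/
def nestedLoop (k : ℕ → ℕ) (n : ℕ) : FundamentalGroup earring earringBase :=
  periodicLoop (earringNested k n) (earringNested_natCast k n)

/-- Once the power is written as a reparametrized loop, both sides are the same path: the circle on
the first half, the inner loop `k n` times on the second. -/
theorem nestedLoop_eq (k : ℕ → ℕ) (n : ℕ) : nestedLoop k n = nestedLoop k (n + 1) ^ k n *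
    periodicLoop (earringCircle n) (earringCircle_natCast n) := by
  rw [nestedLoop, nestedLoop, periodicLoop_pow _ _ (earringNested_add_one k (n + 1))]
  refine congrArg Path.Homotopic.Quotient.mk (a₂ := Path.trans _ _) ?_
  ext t : 2
  rw [Path.trans_apply]
  split_ifs with h
  · exact earringNested_of_le k n t.2.1 h
  · exact earringNested_of_ge k n (not_le.1 h).le t.2.2

/-- The loop meets only circles `2 ^ j` with `j ≥ n > m`, all sent to `0`, so the zero function is a
lift. -/
theorem earringWinding_nestedLoop (k : ℕ → ℕ) {m n : ℕ} (h : m < n) :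
    earringWinding m (nestedLoop k n) = 1 := by
  refine windingHom_of_lift _ _ _ ⟨fun _ => 0, by fun_prop⟩ rfl fun t => ?_
  obtain ⟨j, u, hj, h1⟩ := exists_nestedCirc_eq k n t
  have h2 : earringNested k n t = earringCircle j u := Subtype.ext h1
  have h3 := windingMap_earringCircle m j u
  rw [if_neg (by omega), ← h2] at h3
  exact h3.symm

theorem uncountable_fundamentalGroup_earring :
    Uncountable (FundamentalGroup earring earringBase) :=
  uncountable_of_recursion earringWinding _ earringWinding_circle fun k =>
    ⟨nestedLoop k, nestedLoop_eq k, fun _ _ => earringWinding_nestedLoop k⟩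

theorem not_isFreeGroup_fundamentalGroup_earring :
    ¬ IsFreeGroup (FundamentalGroup earring earringBase) :=
  not_isFreeGroup_of_recursion earringWinding _ earringWinding_circle fun k =>
    ⟨nestedLoop k, nestedLoop_eq k, fun _ _ => earringWinding_nestedLoop k⟩

/-! ### Change of space and base point -/

theorem nonempty_fundamentalGroup_mulEquiv {X Y : Type} [TopologicalSpace X] [TopologicalSpace Y]
    [PathConnectedSpace Y] (e : X ≃ₕ Y) (x : X) (y : Y) :
    Nonempty (FundamentalGroup X x ≃* FundamentalGroup Y y) := by
  let E := FundamentalGroupoidFunctor.equivOfHomotopyEquiv e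
  let f : FundamentalGroup X x ≃* FundamentalGroup Y (e.toFun x) :=
    E.fullyFaithfulFunctor.mulEquivEnd (FundamentalGroupoid.mk x)
  exact ⟨f.trans (FundamentalGroup.fundamentalGroupMulEquivOfPathConnected _ y)⟩

theorem nonempty_fundamentalGroup_HR_mulEquiv (x : HR) :
    Nonempty (FundamentalGroup HR x ≃* FreeGroup ℕ) := by
  obtain ⟨f⟩ := nonempty_fundamentalGroup_mulEquiv HR.homotopyEquivWedge x CircleWedge.base
  exact ⟨f.trans (MulEquiv.ofBijective wedgeHom
    ⟨wedgeHom_injective, CircleWedge.wedgeHom_surjective⟩).symm⟩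

theorem countable_fundamentalGroup_HR (x : HR) : Countable (FundamentalGroup HR x) := by
  obtain ⟨f⟩ := nonempty_fundamentalGroup_HR_mulEquiv x
  have : Countable (FreeGroup ℕ) := Quot.mk_surjective.countable
  exact f.injective.countable

instance : PathConnectedSpace (Collapse ropes) :=
  Quotient.mk_surjective.pathConnectedSpace (collapseMap ropes).continuous

instance : PathConnectedSpace earring :=
  earringHomeo.surjective.pathConnectedSpace earringHomeo.continuous

theorem fundamentalGroup_collapse (q : Collapse ropes) :
    Uncountable (FundamentalGroup (Collapse ropes) q) ∧
      ¬ IsFreeGroup (FundamentalGroup (Collapse ropes) q) := by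
  obtain ⟨f⟩ := nonempty_fundamentalGroup_mulEquiv earringHomeo.toHomotopyEquiv q earringBase
  have := uncountable_fundamentalGroup_earring
  exact ⟨f.symm.injective.uncountable, fun h =>
    not_isFreeGroup_fundamentalGroup_earring (IsFreeGroup.ofMulEquiv f)⟩

theorem not_surjective_map_collapse (x : HR) :
    ¬ Function.Surjective (FundamentalGroup.map (collapseMap ropes) x) := by
  intro h
  have := countable_fundamentalGroup_HR x
  have := (fundamentalGroup_collapse (collapseMap ropes x)).1
  exact not_countable h.countable

/-- Every neighbourhood of the base point contains a whole circle number `2 ^ n`, and its winding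
number `1` survives any homotopy in the full space. -/
theorem not_semilocallySimplyConnected_collapse :
    ¬ SemilocallySimplyConnected (Collapse ropes) := by
  intro h
  obtain ⟨U, hU, hγ⟩ := h (earringHomeo.symm earringBase)
  have hV : earringHomeo.symm ⁻¹' U ∈ 𝓝 earringBase :=
    earringHomeo.symm.continuous.continuousAt.preimage_mem_nhds hU
  obtain ⟨ε, hε, hball⟩ := Metric.mem_nhds_iff.1 hV
  obtain ⟨n, hn⟩ := exists_pow_lt_of_lt_one hε (by norm_num : (1 / 2 : ℝ) < 1)
  let γ := periodicPath (earringCircle n) (earringCircle_natCast n)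
  have h1 := hγ (γ.map earringHomeo.symm.continuous) (by
    intro t
    refine hball ?_
    rw [Metric.mem_ball, Subtype.dist_eq, dist_eq_norm]
    exact (norm_centredCirc_le n t).trans_lt hn)
  have h2 := (h1.map ⟨earringHomeo, earringHomeo.continuous⟩).pathCast
    (earringHomeo.apply_symm_apply earringBase).symm
    (earringHomeo.apply_symm_apply earringBase).symm
  have h3 : γ.Homotopic (Path.refl earringBase) := by
    convert h2 using 1
    · ext1
      funext t
      exact (earringHomeo.apply_symm_apply _).symm
    · ext1
      funext t
      exact (earringHomeo.apply_symm_apply _).symm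
  have h4 := earringWinding_circle n n
  rw [if_pos rfl] at h4
  have h5 : periodicLoop (earringCircle n) (earringCircle_natCast n) = 1 :=
    Path.Homotopic.Quotient.eq.2 h3
  rw [h5, map_one] at h4
  exact one_ne_zero (α := ℝ) (Multiplicative.ofAdd.injective h4.symm)

end HawaiianRopes

end

theorem mainTheorem2 :
    -- `HR` is homotopy equivalent to the wedge of countably many circles
    Nonempty (HawaiianRopes.HR ≃ₕ HawaiianRopes.CircleWedge) ∧
    -- its fundamental group is free on countably many generators, hence countable
    (∀ x : HawaiianRopes.HR,
      Nonempty (FundamentalGroup HawaiianRopes.HR x ≃* FreeGroup ℕ) ∧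
      Countable (FundamentalGroup HawaiianRopes.HR x)) ∧
    -- `A` is closed and `HR / A` is homeomorphic to the Hawaiian earring
    IsClosed HawaiianRopes.ropes ∧
    Nonempty (HawaiianRopes.Collapse HawaiianRopes.ropes ≃ₜ HawaiianRopes.earring) ∧
    -- the fundamental group of `HR / A` is uncountable and not free
    (∀ q : HawaiianRopes.Collapse HawaiianRopes.ropes,
      Uncountable (FundamentalGroup (HawaiianRopes.Collapse HawaiianRopes.ropes) q) ∧
      ¬ IsFreeGroup (FundamentalGroup (HawaiianRopes.Collapse HawaiianRopes.ropes) q)) ∧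
    -- `HR` is locally path connected and the fibres of `HR → HR / A` are connected, but
    -- `HR / A` is not semi-locally simply connected
    LocallyPathConnectedSpace HawaiianRopes.HR ∧
    (∀ q : HawaiianRopes.Collapse HawaiianRopes.ropes,
      IsConnected (HawaiianRopes.collapseMap HawaiianRopes.ropes ⁻¹' {q})) ∧
    ¬ HawaiianRopes.SemilocallySimplyConnected (HawaiianRopes.Collapse HawaiianRopes.ropes) ∧
    -- and the induced homomorphism is not surjective, for any base point
    (∀ x : HawaiianRopes.HR,
      ¬ Function.Surjective
        (FundamentalGroup.map (HawaiianRopes.collapseMap HawaiianRopes.ropes) x)) :=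
  ⟨⟨HawaiianRopes.HR.homotopyEquivWedge⟩,
    fun x => ⟨HawaiianRopes.nonempty_fundamentalGroup_HR_mulEquiv x,
      HawaiianRopes.countable_fundamentalGroup_HR x⟩,
    HawaiianRopes.isClosed_ropes, ⟨HawaiianRopes.earringHomeo⟩,
    HawaiianRopes.fundamentalGroup_collapse, HawaiianRopes.locallyPathConnectedSpace_HR,
    HawaiianRopes.isConnected_fiber_collapseMap HawaiianRopes.isConnected_ropes,
    HawaiianRopes.not_semilocallySimplyConnected_collapse,
    HawaiianRopes.not_surjective_map_collapse⟩
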